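/- Let $K$ be any field and let $H$ and $G$ be finite groups. For a finite group $\Gamma$, let $\Gamma$ act on the rational function field $K(x(g) : g\in\Gamma)$ by $K$-automorphisms via $h\cdot x(g)=x(hg)$, and let $K(\Gamma)=K(x(g) : g\in \Gamma)^{\Gamma}$ be the fixed field. Let $H\wr G=H^{G}\rtimes G$ be the (regular) wreath product, with multiplication $(x,\sigma)(y,\tau)=(x\cdot{}^{\sigma}y,\sigma\tau)$, where $({}^{\sigma}y)_g=y_{\sigma^{-1}g}$. A field extension $E/F$ is called rational if $E$ is $F$-isomorphic to a rational function field $F(t_1,\dots,t_n)$ for some $n\ge 0$, and stably rational if $E(w_1,\dots,w_m)$ is rational over $F$ for some $m\ge 0$, where $w_1,\dots,w_m$ are algebraically independent over $E$. If $K(H)$ is rational (resp. stably rational) over $K$, then $K(H\wr G)$ is rational (resp. stably rational) over $K(G)$; that is, there is a $K$-embedding of $K(G)$ into $K(H\wr G)$ such that $K(H\wr G)$ is rational (resp. stably rational) over the image of $K(G)$. -/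

import Mathlib

/-- The rational function field `K(x_s : s ∈ S)`, in one variable for each element of `S`. -/
abbrev RatFuncField (S K : Type*) [Field K] : Type _ :=
  FractionRing (MvPolynomial S K)

/-- The regular action of `G` on `K(x(g) : g ∈ G)` by `K`-automorphisms, determined by
`h · x(g) = x(h * g)`. -/
noncomputable def regularAction (K G : Type*) [Field K] [Group G] :
    G →* (RatFuncField G K ≃ₐ[K] RatFuncField G K) where
  toFun h := IsFractionRing.fieldEquivOfAlgEquivHom K (RatFuncField G K)
    (MvPolynomial.renameEquiv K (Equiv.mulLeft h))
  map_one' := by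
    have h1 : MvPolynomial.renameEquiv K (Equiv.mulLeft (1 : G)) = 1 := by
      ext p; simp
    rw [h1, map_one]
  map_mul' a b := by
    rw [← map_mul]
    congr 1
    ext p
    simp only [AlgEquiv.mul_apply, MvPolynomial.renameEquiv_apply, MvPolynomial.rename_rename]
    congr 2
    ext g
    simp [mul_assoc]

theorem regularAction_X (K G : Type*) [Field K] [Group G] (h g : G) :
    regularAction K G h (algebraMap (MvPolynomial G K) (RatFuncField G K) (MvPolynomial.X g)) =
      algebraMap (MvPolynomial G K) (RatFuncField G K) (MvPolynomial.X (h * g)) := by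
  simp [regularAction]

/-- The field `K(G) = K(x(g) : g ∈ G)^G` of invariants of the regular action of `G`. -/
noncomputable def noetherField (K G : Type*) [Field K] [Group G] :
    IntermediateField K (RatFuncField G K) :=
  IntermediateField.fixedField (regularAction K G).range

theorem mem_noetherField_iff (K G : Type*) [Field K] [Group G] (f : RatFuncField G K) :
    f ∈ noetherField K G ↔ ∀ h : G, regularAction K G h f = f := by
  simp [noetherField]

/-- The extension `E / F` is rational: it is purely transcendental in finitely many variables,
that is, `E` is `F`-isomorphic to a rational function field `F(t_1, …, t_n)` (`n = 0` allowed). -/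
def IsRationalOver (F E : Type*) [Field F] [Field E] [Algebra F E] : Prop :=
  ∃ n : ℕ, Nonempty (E ≃ₐ[F] RatFuncField (Fin n) F)

/-- The extension `E / F` is stably rational: `E(w_1, …, w_m)` is rational over `F` for some `m`,
where `w_1, …, w_m` are algebraically independent over `E`. -/
def IsStablyRationalOver (F E : Type*) [Field F] [Field E] [Algebra F E] : Prop :=
  ∃ m : ℕ, IsRationalOver F (RatFuncField (Fin m) E)

/-! Write Γ = H ≀ G and let J be a finite set of extra variables such that K(H)(J) is generated over
K by an independent family t. Everything happens in R = K(Γ ⊔ (J × G)), where Γ acts regularly on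
the first variables and through G on the others. The field R^Γ is described in two ways.

The tool is the no-name lemma `exists_fixed_generators`: if Γ acts faithfully on L and affinely over
L on independent y, then L(y)^Γ is purely transcendental over L^Γ. With L generated by the regular
variables, it shows that R^Γ is K(Γ) with variables indexed by J × G adjoined.

For the second description, Γ acts imprimitively on H × G. Summing the regular variables over the
fibres of Γ → H × G, and keeping those of J × G, gives block variables y: for each g a copy of H ⊔
J, on which H^G acts through its g-th factor. By the no-name lemma R^Γ is purely transcendental over
K(y)^Γ. The H-invariants of one block are K(t) (`exists_generators_sumFixed`), so K(y)^Γ = K(T)^G,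
where T consists of a copy of t for each g and G permutes the copies regularly
(`wreath_invariants`). The orbit of one member of t gives a copy of K(G), and a third use of the
no-name lemma makes K(T)^G purely transcendental over it.

Hence K(Γ)(J × G) is rational over a copy of K(G), which lies in K(Γ) provided the chosen member of
t lies in K(H). If K(H) is rational, J is empty and this is automatic. In the stable case K(H) =
M(f) with f transcendental over M, and f is made a generator by exchanging it with one additional
variable. -/

open IntermediateField RegularWreathProduct

/-! ### Transcendence degree and change of base field. -/

/-- A family of at most as many elements as an algebraically independent family `y`, over which
every member of `y` is algebraic, is itself algebraically independent. -/
theorem AlgebraicIndependent.exchange {F E ι κ : Type*} [Field F] [Field E] [Algebra F E]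
    [Finite ι] [Finite κ] {y : ι → E} (hy : AlgebraicIndependent F y) {s : κ → E}
    (hc : Nat.card κ ≤ Nat.card ι)
    (h : ∀ i, IsAlgebraic (adjoin F (Set.range s)) (y i)) :
    AlgebraicIndependent F s ∧ Nat.card κ = Nat.card ι := by
  -- In the matroid of algebraic independence, |ι| ≤ rank of `s` ≤ size of its range ≤ |κ| ≤ |ι|.
  -- Equality throughout forces `s` to be injective and independent.
  have hsub : Set.range y ⊆ (AlgebraicIndependent.matroid F E).closure (Set.range s) := by
    rintro _ ⟨i, rfl⟩
    rw [AlgebraicIndependent.matroid_closure_eq, SetLike.mem_coe, Subalgebra.mem_algebraicClosure]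
    exact isAlgebraic_adjoin_iff.1 (h i)
  have hyI : (AlgebraicIndependent.matroid F E).Indep (Set.range y) := by
    rw [AlgebraicIndependent.matroid_indep_iff]
    exact hy.to_subtype_range
  have hrk : (Set.range y).encard ≤ (AlgebraicIndependent.matroid F E).eRk (Set.range s) := by
    rw [← hyI.eRk_eq_encard, ← Matroid.eRk_closure_eq _ (Set.range s)]
    exact Matroid.eRk_mono _ hsub
  have hycard : (Set.range y).encard = Nat.card ι := by
    rw [← (Set.finite_range y).cast_ncard_eq, Set.ncard_range_of_injective hy.injective]
  have hrk2 := (AlgebraicIndependent.matroid F E).eRk_le_encard (Set.range s)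
  rw [hycard] at hrk
  have hscard : (Nat.card ι : ℕ∞) ≤ (Set.range s).encard := hrk.trans hrk2
  rw [← (Set.finite_range s).cast_ncard_eq, Nat.cast_le] at hscard
  have hle : (Set.range s).ncard ≤ Nat.card κ := by
    have := Finite.card_range_le s
    rwa [← Nat.card_coe_set_eq]
  have heq : Nat.card κ = Nat.card ι := le_antisymm hc (hscard.trans hle)
  refine ⟨?_, heq⟩
  have hinj : Function.Injective s := by
    have : Function.Injective (Set.rangeFactorization s) := by
      refine ((Nat.bijective_iff_surjective_and_card _).2 ⟨Set.rangeFactorization_surjective, ?_⟩).1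
      rw [Nat.card_coe_set_eq]; omega
    intro a b hab
    exact this (Subtype.ext hab)
  rw [← algebraicIndependent_subtype_range hinj]
  refine (AlgebraicIndependent.matroid_indep_iff (R := F)).1 ?_
  rw [Matroid.indep_iff_eRk_eq_encard_of_finite (Set.finite_range s)]
  refine le_antisymm hrk2 (le_trans ?_ hrk)
  rw [← (Set.finite_range s).cast_ncard_eq, Nat.cast_le]
  omega

theorem IsAlgebraic.map_of_le {K Q R : Type*} [Field K] [Field Q] [Field R] [Algebra K Q]
    [Algebra K R] {A : IntermediateField K Q} {B : IntermediateField K R} {q : Q}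
    (hq : IsAlgebraic A q) (j : Q →ₐ[K] R) (h : ∀ a ∈ A, j a ∈ B) : IsAlgebraic B (j q) :=
  hq.ringHom_of_comp_eq ((j : Q →+* R).restrict A B h) j
    ((j : Q →+* R).restrict A B h).injective rfl

theorem AlgebraicIndependent.of_le {K R ι : Type*} [Field K] [Field R] [Algebra K R]
    {A B : IntermediateField K R} {s : ι → R} (hs : AlgebraicIndependent B s) (h : A ≤ B) :
    AlgebraicIndependent A s :=
  AlgebraicIndependent.of_ringHom_of_comp_eq (IntermediateField.inclusion h) (RingHom.id R) hs
    (IntermediateField.inclusion h).injective rfl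

/-! ### Galois descent and the no-name lemma. -/

section GroupAction

variable {K R Γ : Type*} [Field K] [Field R] [Algebra K R] [Group Γ] (ρ : Γ →* (R ≃ₐ[K] R))

theorem mem_fixedField_range_iff {x : R} :
    x ∈ IntermediateField.fixedField ρ.range ↔ ∀ γ, ρ γ x = x := by
  simp

/-- Dedekind independence for automorphisms that are distinct on the subfield `L`. -/
theorem eq_zero_of_sum_mul_eq_zero [Fintype Γ] (L : IntermediateField K R)
    (hf : ∀ γ, (∀ l ∈ L, ρ γ l = l) → γ = 1) {c : Γ → R}
    (hc : ∀ l ∈ L, ∑ γ, c γ * ρ γ l = 0) : c = 0 := by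
  let χ : Γ → (L →* R) := fun γ => ((ρ γ : R →* R)).comp (L.val : L →* R)
  have hχ : Function.Injective χ := by
    intro a b hab
    have : b⁻¹ * a = 1 := by
      refine hf _ fun l hl => ?_
      have h1 : ρ a l = ρ b l := DFunLike.congr_fun hab (⟨l, hl⟩ : L)
      rw [map_mul, AlgEquiv.mul_apply, h1, ← AlgEquiv.mul_apply, ← map_mul, inv_mul_cancel,
        map_one, AlgEquiv.one_apply]
    exact (inv_mul_eq_one.1 this).symm
  have hli := (linearIndependent_monoidHom L R).comp χ hχ
  rw [Fintype.linearIndependent_iff] at hli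
  funext γ
  refine hli c ?_ γ
  funext l
  simpa [χ] using hc l l.2

theorem sum_mem_fixedField [Fintype Γ] (x : R) :
    ∑ γ, ρ γ x ∈ IntermediateField.fixedField ρ.range := by
  rw [mem_fixedField_range_iff]
  intro γ
  rw [map_sum]
  simp_rw [← AlgEquiv.mul_apply, ← map_mul]
  exact Fintype.sum_equiv (Equiv.mulLeft γ) _ _ fun _ => rfl

/-- By Dedekind the trace is not identically zero on L; dividing an element by its nonzero,
invariant trace normalises it. -/
theorem exists_sum_eq_one [Fintype Γ] (L : IntermediateField K R)
    (hst : ∀ γ, ∀ l ∈ L, ρ γ l ∈ L) (hf : ∀ γ, (∀ l ∈ L, ρ γ l = l) → γ = 1) :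
    ∃ a ∈ L, ∑ γ, ρ γ a = 1 := by
  obtain ⟨b, hb, hb0⟩ : ∃ b ∈ L, ∑ γ, ρ γ b ≠ 0 := by
    by_contra! h
    have := eq_zero_of_sum_mul_eq_zero ρ L hf (c := fun _ => 1) (by simpa using h)
    exact one_ne_zero (congr_fun this 1)
  have hfix := (mem_fixedField_range_iff ρ).1 (sum_mem_fixedField ρ b)
  refine ⟨b * (∑ γ, ρ γ b)⁻¹, L.mul_mem hb (L.inv_mem (L.sum_mem fun γ _ => hst γ b hb)), ?_⟩
  have : ∀ γ, ρ γ (b * (∑ γ, ρ γ b)⁻¹) = ρ γ b * (∑ γ, ρ γ b)⁻¹ := by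
    intro γ
    rw [map_mul, map_inv₀, hfix]
  simp_rw [this]
  rw [← Finset.sum_mul, mul_inv_cancel₀ hb0]

/-- Speiser's lemma: a semilinear representation is spanned by its invariants. -/
theorem le_span_fixed [Finite Γ] (L : IntermediateField K R)
    (hst : ∀ γ, ∀ l ∈ L, ρ γ l ∈ L)
    (hf : ∀ γ, (∀ l ∈ L, ρ γ l = l) → γ = 1) (T : Submodule L R)
    (hT : ∀ γ, ∀ t ∈ T, ρ γ t ∈ T) :
    T ≤ Submodule.span L {t | t ∈ T ∧ ∀ γ, ρ γ t = t} := by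
  have := Fintype.ofFinite Γ
  intro t ht
  by_contra hn
  -- A functional killing all invariants kills the traces of l·t for l in L. This is a relation
  -- between the automorphisms with coefficients φ(γ t), so Dedekind gives φ(t) = 0.
  obtain ⟨φ, hφt, hφ⟩ := Submodule.exists_le_ker_of_notMem hn
  have key := eq_zero_of_sum_mul_eq_zero ρ L hf (c := fun γ => (φ (ρ γ t) : R)) ?_
  · have h1 := congr_fun key 1
    simp only [map_one, AlgEquiv.one_apply, Pi.zero_apply, ZeroMemClass.coe_eq_zero] at h1
    exact hφt h1
  · intro l hl
    have hmem : ∑ γ, ρ γ (l * t) ∈ Submodule.span L {t | t ∈ T ∧ ∀ γ, ρ γ t = t} :=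
      Submodule.subset_span ⟨T.sum_mem fun γ _ => hT γ _ (T.smul_mem (⟨l, hl⟩ : L) ht),
        (mem_fixedField_range_iff ρ).1 (sum_mem_fixedField ρ _)⟩
    have h0 : φ (∑ γ, ρ γ (l * t)) = 0 := hφ hmem
    have h2 : ∀ γ, ρ γ (l * t) = (⟨ρ γ l, hst γ l hl⟩ : L) • ρ γ t := fun γ => map_mul _ _ _
    simp_rw [h2, map_sum, map_smul] at h0
    have h3 := congr_arg (algebraMap L R) h0
    rw [map_sum, map_zero] at h3
    rw [← h3]
    exact Finset.sum_congr rfl fun γ _ => mul_comm _ _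

/-- The orbit polynomial ∏ (X - γ l) is monic, has invariant coefficients in L, and vanishes at l.
-/
theorem isAlgebraic_inf_fixedField [Finite Γ] (L : IntermediateField K R)
    (hst : ∀ γ, ∀ l ∈ L, ρ γ l ∈ L) {l : R} (hl : l ∈ L) :
    IsAlgebraic ↥(L ⊓ IntermediateField.fixedField ρ.range) l := by
  have := Fintype.ofFinite Γ
  let p : Polynomial R := ∏ γ, (Polynomial.X - Polynomial.C (ρ γ l))
  have hp : p.Monic := Polynomial.monic_prod_of_monic _ _ fun γ _ => Polynomial.monic_X_sub_C _
  have hpL : p ∈ Polynomial.lifts (algebraMap L R) := by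
    refine Subsemiring.prod_mem _ fun γ _ => ?_
    rw [Polynomial.mem_lifts]
    exact ⟨Polynomial.X - Polynomial.C ⟨ρ γ l, hst γ l hl⟩, by simp⟩
  have hpfix : ∀ γ, p.map (ρ γ : R →+* R) = p := by
    intro γ
    simp only [p, Polynomial.map_prod, Polynomial.map_sub, Polynomial.map_X, Polynomial.map_C]
    refine Fintype.prod_equiv (Equiv.mulLeft γ) _ _ fun δ => ?_
    simp [AlgEquiv.mul_apply]
  have hlift : p ∈ Polynomial.lifts
      (algebraMap ↥(L ⊓ IntermediateField.fixedField ρ.range) R) := by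
    rw [Polynomial.lifts_iff_coeff_lifts] at hpL ⊢
    intro n
    obtain ⟨x, hx⟩ := hpL n
    refine ⟨⟨p.coeff n, ?_, ?_⟩, rfl⟩
    · rw [← hx]; exact x.2
    · rw [SetLike.mem_coe, mem_fixedField_range_iff]
      intro γ
      conv_rhs => rw [← hpfix γ]
      rw [Polynomial.coeff_map]; rfl
  obtain ⟨q, hq⟩ := (Polynomial.mem_lifts _).1 hlift
  refine ⟨q, ?_, ?_⟩
  · rintro rfl
    rw [Polynomial.map_zero] at hq
    exact hp.ne_zero hq.symm
  · rw [Polynomial.aeval_def, ← Polynomial.eval_map, hq, Polynomial.eval_prod]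
    exact Finset.prod_eq_zero (Finset.mem_univ 1) (by simp)

/-- An invariant r equals the trace of a·r when a has trace 1, and the trace is F-linear, so only
the spanning set M needs checking. This replaces a Galois degree count. -/
theorem mem_of_mem_span_of_fixed [Fintype Γ] {F : IntermediateField K R}
    (hF : F ≤ IntermediateField.fixedField ρ.range) {M : Set R} {a : R} (ha : ∑ γ, ρ γ a = 1)
    (hM : ∀ m ∈ M, ∑ γ, ρ γ (a * m) ∈ F) {r : R} (hr : r ∈ Submodule.span F M)
    (hfix : ∀ γ, ρ γ r = r) : r ∈ F := by
  have key : ∑ γ, ρ γ (a * r) ∈ F := by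
    clear hfix
    induction hr using Submodule.span_induction with
    | mem x h => exact hM x h
    | zero => simp
    | add x y _ _ hx hy =>
      simp_rw [mul_add, map_add, Finset.sum_add_distrib]
      exact F.add_mem hx hy
    | smul c x _ hx =>
      have : ∀ γ, ρ γ (a * c • x) = c * ρ γ (a * x) := by
        intro γ
        have hc := (mem_fixedField_range_iff ρ).1 (hF c.2) γ
        rw [Algebra.smul_def, mul_left_comm, map_mul]
        exact congrArg (· * _) hc
      simp_rw [this, ← Finset.mul_sum]
      exact F.mul_mem c.2 hx
  simp_rw [map_mul, hfix, ← Finset.sum_mul, ha, one_mul] at key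
  exact key

/-- If `M` is a set of elements algebraic over `F`, closed under products, then the field generated
by `F` and `M` is the `F`-span of `M`. -/
theorem mem_span_of_mem_sup_adjoin {F : IntermediateField K R} (M : Submonoid R)
    (hM : ∀ m ∈ M, IsAlgebraic F m) {r : R}
    (hr : r ∈ F ⊔ IntermediateField.adjoin K (M : Set R)) :
    r ∈ Submodule.span F (M : Set R) := by
  have h1 : F ⊔ IntermediateField.adjoin K (M : Set R) ≤
      (IntermediateField.adjoin F (M : Set R)).restrictScalars K := by
    refine sup_le (fun x hx => ?_) ?_
    · exact (IntermediateField.adjoin F (M : Set R)).algebraMap_mem ⟨x, hx⟩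
    · rw [IntermediateField.adjoin_le_iff]
      exact IntermediateField.subset_adjoin F (M : Set R)
  have h2 : r ∈ (IntermediateField.adjoin F (M : Set R)).toSubalgebra := h1 hr
  rw [IntermediateField.adjoin_toSubalgebra_of_isAlgebraic hM, ← Subalgebra.mem_toSubmodule,
    Algebra.adjoin_eq_span, Submonoid.closure_eq] at h2
  exact h2

/-- The no-name lemma, for an action that is affine over a stable subfield `L` on which it is
faithful. -/
theorem exists_fixed_generators [Finite Γ] (L : IntermediateField K R)
    (hst : ∀ γ, ∀ l ∈ L, ρ γ l ∈ L) (hf : ∀ γ, (∀ l ∈ L, ρ γ l = l) → γ = 1)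
    {ι : Type*} [Finite ι] (y : ι → R) (hy : AlgebraicIndependent L y)
    (hT : ∀ γ i, ρ γ (y i) ∈ Submodule.span L (insert 1 (Set.range y))) :
    ∃ s : ι → R, AlgebraicIndependent L s ∧
      (L ⊔ IntermediateField.adjoin K (Set.range y)) ⊓ IntermediateField.fixedField ρ.range =
        (L ⊓ IntermediateField.fixedField ρ.range) ⊔
          IntermediateField.adjoin K (Set.range s) := by
  have := Fintype.ofFinite Γ
  have := Fintype.ofFinite ι
  set T := Submodule.span L (insert 1 (Set.range y)) with hTdef
  have hTst : ∀ γ, ∀ t ∈ T, ρ γ t ∈ T := by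
    intro γ t ht
    induction ht using Submodule.span_induction with
    | mem x h =>
      rcases h with rfl | ⟨i, rfl⟩
      · rw [map_one]; exact Submodule.subset_span (Set.mem_insert _ _)
      · exact hT γ i
    | zero => simp
    | add x y _ _ hx hy => rw [map_add]; exact T.add_mem hx hy
    | smul c x _ hx =>
      have : ρ γ (c • x) = (⟨ρ γ c, hst γ c c.2⟩ : L) • ρ γ x := map_mul _ _ _
      rw [this]; exact T.smul_mem _ hx
  have hspan := le_span_fixed ρ L hst hf T hTst
  set V := {t | t ∈ T ∧ ∀ γ, ρ γ t = t}
  have h1V : ({1} : Set R) ⊆ V := by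
    rw [Set.singleton_subset_iff]
    exact ⟨Submodule.subset_span (Set.mem_insert _ _), fun γ => map_one _⟩
  -- An L-basis of T made of invariants and containing 1; the new generators are its other members.
  obtain ⟨b, hbV, h1b, hVb, hbI⟩ := exists_linearIndepOn_id_extension
    (LinearIndepOn.singleton (R := L) (v := id) (one_ne_zero : (1 : R) ≠ 0)) h1V
  have hTb : T = Submodule.span L b :=
    le_antisymm (hspan.trans (Submodule.span_le.2 hVb))
      (Submodule.span_le.2 fun x hx => (hbV hx).1)
  have hwfin : (insert 1 (Set.range y)).Finite := (Set.finite_range y).insert 1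
  have hbfin : b.Finite := by
    have : Finite ↥(insert 1 (Set.range y)) := hwfin
    exact hbI.linearIndependent.finite_of_le_span_finite _ (insert 1 (Set.range y)) (by
      rintro _ ⟨x, rfl⟩
      exact (hbV x.2).1)
  have hbcard : b.ncard ≤ Nat.card ι + 1 := by
    have := hwfin.fintype
    have := hbfin.fintype
    have h1 := finrank_span_le_card (R := L) (insert 1 (Set.range y))
    rw [← hTdef, hTb, finrank_span_set_eq_card hbI, ← Set.ncard_eq_toFinset_card',
      ← Set.ncard_eq_toFinset_card'] at h1
    refine h1.trans ((Set.ncard_insert_le _ _).trans ?_)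
    rw [Set.ncard_range_of_injective hy.injective]
  have hκcard : Nat.card ↥(b \ {1}) ≤ Nat.card ι := by
    rw [Nat.card_coe_set_eq, Set.ncard_sdiff_singleton_of_mem (h1b rfl)]
    omega
  have : Finite ↥(b \ {1}) := hbfin.subset Set.sdiff_subset
  let s₀ : ↥(b \ {1}) → R := (↑)
  have hs₀ : Set.range s₀ = b \ {1} := Subtype.range_coe
  have hTle : ∀ t ∈ T, t ∈ L ⊔ IntermediateField.adjoin K (Set.range s₀) := by
    intro t ht
    rw [hTb] at ht
    induction ht using Submodule.span_induction with
    | mem x h =>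
      by_cases hx : x = 1
      · rw [hx]; exact one_mem _
      · refine (le_sup_right : IntermediateField.adjoin K (Set.range s₀) ≤ _)
          (IntermediateField.subset_adjoin _ _ ?_)
        rw [hs₀]; exact ⟨h, hx⟩
    | zero => exact zero_mem _
    | add x y _ _ hx hy => exact add_mem hx hy
    | smul c x _ hx =>
      exact mul_mem ((le_sup_left : L ≤ L ⊔ IntermediateField.adjoin K (Set.range s₀)) c.2) hx
  have hle1 : L ⊔ IntermediateField.adjoin K (Set.range s₀) ≤
      (IntermediateField.adjoin L (Set.range s₀)).restrictScalars K := by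
    refine sup_le (fun x hx => ?_) ?_
    · exact (IntermediateField.adjoin L (Set.range s₀)).algebraMap_mem ⟨x, hx⟩
    · rw [IntermediateField.adjoin_le_iff]
      exact IntermediateField.subset_adjoin L (Set.range s₀)
  have hyT : ∀ i, y i ∈ T := fun i => Submodule.subset_span (Set.mem_insert_of_mem _ ⟨i, rfl⟩)
  -- The dimension of T bounds their number by |ι|, and they generate every y i over L, so exchange
  -- yields independence.
  obtain ⟨hs₀I, hcard⟩ := hy.exchange (s := s₀) hκcard fun i =>
    isAlgebraic_algebraMap (⟨y i, hle1 (hTle _ (hyT i))⟩ :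
      IntermediateField.adjoin L (Set.range s₀))
  let e : ι ≃ ↥(b \ {1}) := (Finite.equivFin ι).trans ((finCongr hcard.symm).trans (Finite.equivFin _).symm)
  have hrange : Set.range (s₀ ∘ e) = Set.range s₀ := e.surjective.range_comp s₀
  refine ⟨s₀ ∘ e, hs₀I.comp e e.injective, ?_⟩
  rw [hrange]
  have hsfix : IntermediateField.adjoin K (Set.range s₀) ≤
      IntermediateField.fixedField ρ.range := by
    rw [IntermediateField.adjoin_le_iff, hs₀]
    exact fun x hx => (mem_fixedField_range_iff ρ).2 (hbV hx.1).2
  have hsup : L ⊔ IntermediateField.adjoin K (Set.range y) =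
      L ⊔ IntermediateField.adjoin K (Set.range s₀) := by
    refine le_antisymm (sup_le le_sup_left ?_) (sup_le le_sup_left ?_)
    · rw [IntermediateField.adjoin_le_iff]
      rintro _ ⟨i, rfl⟩
      exact hTle _ (hyT i)
    · rw [IntermediateField.adjoin_le_iff, hs₀]
      intro x hx
      have hxT := (hbV hx.1).1
      clear hx
      induction hxT using Submodule.span_induction with
      | mem x h =>
        rcases h with rfl | h
        · exact one_mem _
        · exact (le_sup_right : IntermediateField.adjoin K (Set.range y) ≤ _)
            (IntermediateField.subset_adjoin _ _ h)
      | zero => exact zero_mem _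
      | add x y _ _ hx hy => exact add_mem hx hy
      | smul c x _ hx =>
        exact mul_mem ((le_sup_left : L ≤ L ⊔ IntermediateField.adjoin K (Set.range y)) c.2) hx
  rw [hsup]
  refine le_antisymm ?_ (sup_le (inf_le_inf_right _ le_sup_left) (le_inf le_sup_right hsfix))
  rintro r ⟨hr, hrfix⟩
  set F := (L ⊓ IntermediateField.fixedField ρ.range) ⊔ IntermediateField.adjoin K (Set.range s₀)
  have hFfix : F ≤ IntermediateField.fixedField ρ.range := sup_le inf_le_right hsfix
  -- Since L is algebraic over its invariants, L(s) is the F-span of L; the trace then sends it into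
  -- F.
  obtain ⟨a, haL, ha⟩ := exists_sum_eq_one ρ L hst hf
  refine mem_of_mem_span_of_fixed ρ hFfix (M := (L : Set R)) ha (fun m hm => ?_) ?_
    ((mem_fixedField_range_iff ρ).1 hrfix)
  · refine (le_sup_left : L ⊓ IntermediateField.fixedField ρ.range ≤ F)
      ⟨L.sum_mem fun γ _ => hst γ _ (L.mul_mem haL hm), sum_mem_fixedField ρ _⟩
  · refine mem_span_of_mem_sup_adjoin L.toSubalgebra.toSubmonoid (fun m hm => ?_) ?_
    · exact (isAlgebraic_inf_fixedField ρ L hst (l := m) hm).map_of_le (AlgHom.id K R)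
        fun x hx => (le_sup_left : _ ≤ F) hx
    · refine (sup_le ?_ ?_ : L ⊔ IntermediateField.adjoin K (Set.range s₀) ≤ _) hr
      · exact le_sup_of_le_right (IntermediateField.subset_adjoin K (L : Set R))
      · exact le_sup_of_le_left le_sup_right

end GroupAction

/-! ### Rational function fields: embeddings and permutation actions. -/

section RatFuncField

variable {K X R : Type*} [Field K] [Field R] [Algebra K R]

/-- The variable `x` of the rational function field. -/
noncomputable def ratVar (K : Type*) {X : Type*} [Field K] (x : X) : RatFuncField X K :=
  algebraMap (MvPolynomial X K) (RatFuncField X K) (MvPolynomial.X x)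

theorem algebraicIndependent_ratVar :
    AlgebraicIndependent K (ratVar K : X → RatFuncField X K) :=
  (MvPolynomial.algebraicIndependent_X X K).map'
    (f := IsScalarTower.toAlgHom K (MvPolynomial X K) (RatFuncField X K))
    (IsFractionRing.injective (MvPolynomial X K) (RatFuncField X K))

/-- The embedding of a rational function field defined by an algebraically independent family. -/
noncomputable def ratLift {y : X → R} (hy : AlgebraicIndependent K y) : RatFuncField X K →ₐ[K] R :=
  IsFractionRing.liftAlgHom (K := RatFuncField X K) (algebraicIndependent_iff_injective_aeval.2 hy)

theorem ratLift_algebraMap {y : X → R} (hy : AlgebraicIndependent K y) (p : MvPolynomial X K) :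
    ratLift hy (algebraMap _ _ p) = MvPolynomial.aeval y p :=
  IsFractionRing.lift_algebraMap (A := MvPolynomial X K) (K := RatFuncField X K)
    (g := (MvPolynomial.aeval y : MvPolynomial X K →ₐ[K] R).toRingHom)
    (algebraicIndependent_iff_injective_aeval.2 hy) p

@[simp]
theorem ratLift_ratVar {y : X → R} (hy : AlgebraicIndependent K y) (x : X) :
    ratLift hy (ratVar K x) = y x :=
  (ratLift_algebraMap hy _).trans (MvPolynomial.aeval_X _ _)

theorem ratLift_fieldRange {y : X → R} (hy : AlgebraicIndependent K y) :
    (ratLift hy).fieldRange = IntermediateField.adjoin K (Set.range y) :=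
  IsFractionRing.algHom_fieldRange_eq_of_comp_eq_of_range_eq (g := MvPolynomial.aeval y)
    (f := ratLift hy) (RingHom.ext fun p => ratLift_algebraMap hy p)
    (Algebra.adjoin_range_eq_range_aeval K y).symm

theorem ratFunc_algHom_ext {f g : RatFuncField X K →ₐ[K] R}
    (h : ∀ x, f (ratVar K x) = g (ratVar K x)) : f = g := by
  have h1 : f.comp (IsScalarTower.toAlgHom K (MvPolynomial X K) (RatFuncField X K)) =
      g.comp (IsScalarTower.toAlgHom K (MvPolynomial X K) (RatFuncField X K)) :=
    MvPolynomial.algHom_ext h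
  have h2 : ∀ p, f (algebraMap (MvPolynomial X K) (RatFuncField X K) p) =
      g (algebraMap (MvPolynomial X K) (RatFuncField X K) p) := fun p => AlgHom.congr_fun h1 p
  refine AlgHom.ext fun q => ?_
  obtain ⟨a, b, -, rfl⟩ := IsFractionRing.div_surjective (MvPolynomial X K) q
  rw [map_div₀, map_div₀, h2, h2]

theorem adjoin_ratVar :
    IntermediateField.adjoin K (Set.range (ratVar K : X → RatFuncField X K)) = ⊤ := by
  have h : ratLift (algebraicIndependent_ratVar (K := K) (X := X)) =
      AlgHom.id K (RatFuncField X K) :=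
    ratFunc_algHom_ext fun x => by rw [ratLift_ratVar, AlgHom.id_apply]
  have h1 := ratLift_fieldRange (algebraicIndependent_ratVar (K := K) (X := X))
  rw [← h1, h]
  exact AlgHom.fieldRange_eq_top.2 Function.surjective_id

/-- The action of a group on a rational function field by permutations of the variables. -/
noncomputable def permAction (K : Type*) [Field K] {Γ : Type*} [Group Γ]
    (π : Γ →* Equiv.Perm X) : Γ →* (RatFuncField X K ≃ₐ[K] RatFuncField X K) where
  toFun γ := IsFractionRing.fieldEquivOfAlgEquivHom K (RatFuncField X K)
    (MvPolynomial.renameEquiv K (π γ))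
  map_one' := by
    have h1 : MvPolynomial.renameEquiv K (π (1 : Γ)) = 1 := by
      ext p; simp
    rw [h1, map_one]
  map_mul' a b := by
    rw [← map_mul]
    congr 1
    ext p
    simp only [AlgEquiv.mul_apply, MvPolynomial.renameEquiv_apply, MvPolynomial.rename_rename]
    congr 2
    ext x
    simp

@[simp]
theorem permAction_ratVar {Γ : Type*} [Group Γ] (π : Γ →* Equiv.Perm X) (γ : Γ) (x : X) :
    permAction K π γ (ratVar K x) = ratVar K (π γ x) := by
  simp [permAction, ratVar]

theorem permAction_faithful {Γ : Type*} [Group Γ] {π : Γ →* Equiv.Perm X}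
    (hπ : Function.Injective π) {γ : Γ}
    (h : ∀ x, permAction K π γ (ratVar K x) = ratVar K x) : γ = 1 := by
  apply hπ
  rw [map_one]
  ext x
  have := h x
  rw [permAction_ratVar] at this
  exact algebraicIndependent_ratVar.injective this

theorem regularAction_ratVar {G : Type*} [Group G] (h g : G) :
    regularAction K G h (ratVar K g) = ratVar K (h * g) :=
  regularAction_X K G h g

attribute [irreducible] ratVar ratLift permAction

end RatFuncField

/-! ### Invariants of the wreath product in block variables. -/

section Wreath

variable {K R H G Λ I : Type*} [Field K] [Field R] [Algebra K R] [Group H] [Group G]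

/-- The inclusion of the base group `H ^ G` into `H ≀ᵣ G`. -/
def baseHom (H G : Type*) [Group H] [Group G] : (G → H) →* H ≀ᵣ G where
  toFun x := ⟨x, 1⟩
  map_one' := rfl
  map_mul' x y := by ext <;> simp

variable (ρ : (H ≀ᵣ G) →* (R ≃ₐ[K] R)) (π : H →* Equiv.Perm Λ)
  (y : Λ × G → R) (hy : AlgebraicIndependent K y)

omit [Group G] in
theorem AlgebraicIndependent.fiber {y : Λ × G → R} (hy : AlgebraicIndependent K y) (g : G) :
    AlgebraicIndependent K fun l => y (l, g) :=
  hy.comp (fun l => (l, g)) fun _ _ h => congrArg Prod.fst h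

variable {ρ π y}

/-- Both sides are embeddings of K(Λ), so it suffices to compare variables: w carries block g to
block `w.right * g`, twisted by one component of `w.left`. -/
theorem wreath_apply_ratLift
    (hρ : ∀ w l g, ρ w (y (l, g)) = y (π (w.left (w.right * g)) l, w.right * g))
    (w : H ≀ᵣ G) (g : G) (q : RatFuncField Λ K) :
    ρ w (ratLift (hy.fiber g) q) =
      ratLift (hy.fiber (w.right * g)) (permAction K π (w.left (w.right * g)) q) := by
  have : ((ρ w : R →ₐ[K] R)).comp (ratLift (hy.fiber g)) =
      (ratLift (hy.fiber (w.right * g))).comp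
        (permAction K π (w.left (w.right * g)) : RatFuncField Λ K →ₐ[K] RatFuncField Λ K) := by
    refine ratFunc_algHom_ext fun l => ?_
    simp [hρ]
  exact DFunLike.congr_fun this q

/-- Each factor of H^G acts on its own block only, so expanding the product of the block traces
gives the trace over H^G. -/
theorem sum_base_prod [Fintype H] [Fintype G] [DecidableEq G]
    (hρ : ∀ w l g, ρ w (y (l, g)) = y (π (w.left (w.right * g)) l, w.right * g))
    (q : G → RatFuncField Λ K) :
    ∑ x, ρ (baseHom H G x) (∏ g, ratLift (hy.fiber g) (q g)) =
      ∏ g, ratLift (hy.fiber g) (∑ h, permAction K π h (q g)) := by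
  simp_rw [map_sum]
  rw [Finset.prod_univ_sum, Fintype.piFinset_univ]
  refine Finset.sum_congr rfl fun x _ => ?_
  rw [map_prod]
  refine Finset.prod_congr rfl fun g _ => ?_
  rw [wreath_apply_ratLift hy hρ]
  simp [baseHom]

/-- The invariants of `H ≀ᵣ G` in the field generated by the variables `y`, where the field of
`H`-invariants for one block of variables is generated by the family `t`. -/
theorem wreath_invariants [Finite H] [Finite G] [Finite Λ] [Finite I]
    (hπ : Function.Injective π)
    (hρ : ∀ w l g, ρ w (y (l, g)) = y (π (w.left (w.right * g)) l, w.right * g))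
    {t : I → RatFuncField Λ K} (ht : AlgebraicIndependent K t)
    (htfix : adjoin K (Set.range t) = fixedField (permAction K π).range) :
    AlgebraicIndependent K (fun p : I × G => ratLift (hy.fiber p.2) (t p.1)) ∧
    (∀ σ i g, ρ (inl σ) (ratLift (hy.fiber g) (t i)) = ratLift (hy.fiber (σ * g)) (t i)) ∧
    adjoin K (Set.range y) ⊓ fixedField ρ.range =
      adjoin K (Set.range fun p : I × G => ratLift (hy.fiber p.2) (t p.1)) ⊓
        fixedField (ρ.comp inl).range := by
  classical
  have := Fintype.ofFinite H
  have := Fintype.ofFinite G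
  set T : I × G → R := fun p => ratLift (hy.fiber p.2) (t p.1) with hT
  set F := adjoin K (Set.range T)
  have hmap : ∀ g, ∀ q ∈ adjoin K (Set.range t), ratLift (hy.fiber g) q ∈ F := by
    intro g q hq
    have : (adjoin K (Set.range t)).map (ratLift (hy.fiber g)) ≤ F := by
      rw [adjoin_map, adjoin_le_iff]
      rintro _ ⟨_, ⟨i, rfl⟩, rfl⟩
      exact subset_adjoin _ _ ⟨(i, g), rfl⟩
    exact this ⟨q, hq, rfl⟩
  have hmapfix : ∀ g, ∀ q ∈ fixedField (permAction K π).range, ratLift (hy.fiber g) q ∈ F :=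
    fun g q hq => hmap g q (htfix ▸ hq)
  have halg : ∀ g q, IsAlgebraic F (ratLift (hy.fiber g) q) := fun g q =>
    (isAlgebraic_inf_fixedField (permAction K π) ⊤ (fun _ _ _ => mem_top) (l := q)
      mem_top).map_of_le _ fun a ha => hmapfix g a ha.2
  have hyl : ∀ l g, ratLift (hy.fiber g) (ratVar K l) = y (l, g) := fun l g => ratLift_ratVar _ _
  have htf : ∀ h i, permAction K π h (t i) = t i := by
    intro h i
    have : t i ∈ fixedField (permAction K π).range := htfix ▸ subset_adjoin K _ ⟨i, rfl⟩
    exact (mem_fixedField_range_iff _).1 this h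
  have hFN : ∀ x, ∀ r ∈ F, ρ (baseHom H G x) r = r := by
    intro x
    have : F ≤ fixedField (ρ.comp (baseHom H G)).range := by
      rw [adjoin_le_iff]
      rintro _ ⟨⟨i, g⟩, rfl⟩
      rw [SetLike.mem_coe, mem_fixedField_range_iff]
      intro x
      rw [MonoidHom.comp_apply, hT, wreath_apply_ratLift hy hρ, htf]
      simp [baseHom]
    exact fun r hr => (mem_fixedField_range_iff _).1 (this hr) x
  -- Otherwise exchange, applied to t and the variables, would force equal cardinalities.
  have hcard : Nat.card I ≤ Nat.card Λ := by
    by_contra! hlt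
    refine hlt.ne ((ht.exchange (s := ratVar K) hlt.le fun i => ?_).2)
    rw [adjoin_ratVar]
    exact isAlgebraic_algebraMap (⟨t i, mem_top⟩ : (⊤ : IntermediateField K (RatFuncField Λ K)))
  refine ⟨?_, fun σ i g => ?_, ?_⟩
  · refine (hy.exchange (s := T) ?_ fun ⟨l, g⟩ => ?_).1
    · rw [Nat.card_prod, Nat.card_prod]
      exact Nat.mul_le_mul_right _ hcard
    · rw [← hyl]
      exact halg g _
  · rw [wreath_apply_ratLift hy hρ, htf]
    simp
  · have hFle : F ≤ adjoin K (Set.range y) := by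
      rw [adjoin_le_iff]
      rintro _ ⟨⟨i, g⟩, rfl⟩
      have : T (i, g) ∈ (ratLift (hy.fiber g)).fieldRange := ⟨t i, rfl⟩
      rw [ratLift_fieldRange] at this
      refine adjoin.mono K _ _ ?_ this
      rintro _ ⟨l, rfl⟩
      exact ⟨(l, g), rfl⟩
    refine le_antisymm ?_ ?_
    · rintro r ⟨hr, hrfix⟩
      rw [SetLike.mem_coe, mem_fixedField_range_iff] at hrfix
      refine ⟨?_, (mem_fixedField_range_iff _).2 fun σ => hrfix _⟩
      -- The products of one element per block form a monoid containing every variable. It serves as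
      -- the spanning set, and the product of trace-one elements, one per block, as the element of
      -- trace 1.
      let Φ : (G → RatFuncField Λ K) →* R :=
        { toFun := fun q => ∏ g, ratLift (hy.fiber g) (q g)
          map_one' := by simp
          map_mul' := fun a b => by simp [Finset.prod_mul_distrib] }
      have hΦ : ∀ q, Φ q = ∏ g, ratLift (hy.fiber g) (q g) := fun _ => rfl
      clear_value Φ
      obtain ⟨a, -, ha⟩ := exists_sum_eq_one (permAction K π) ⊤ (fun _ _ _ => mem_top)
        fun h hh => permAction_faithful hπ fun x => hh _ mem_top
      refine mem_of_mem_span_of_fixed (ρ.comp (baseHom H G))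
        (fun r hr => (mem_fixedField_range_iff _).2 fun x => hFN x r hr)
        (M := (MonoidHom.mrange Φ : Set R)) (a := Φ fun _ => a) ?_ ?_ ?_ fun x => hrfix _
      · rw [hΦ]
        refine (sum_base_prod hy hρ _).trans ?_
        simp [ha]
      · rintro _ ⟨q, rfl⟩
        rw [← map_mul, hΦ]
        refine (congrArg (· ∈ F) (sum_base_prod hy hρ _)).mpr ?_
        exact F.prod_mem fun g _ => hmapfix g _ (sum_mem_fixedField _ _)
      · refine mem_span_of_mem_sup_adjoin _ ?_ ?_
        · rintro _ ⟨q, rfl⟩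
          rw [hΦ, ← mem_algebraicClosure_iff]
          exact (algebraicClosure F R).prod_mem fun g _ => mem_algebraicClosure_iff.2 (halg g _)
        · refine (le_sup_right : _ ≤ F ⊔ _) (adjoin.mono K (Set.range y) _ ?_ hr)
          rintro _ ⟨⟨l, g⟩, rfl⟩
          refine ⟨Pi.mulSingle g (ratVar K l), ?_⟩
          rw [hΦ, Finset.prod_eq_single g]
          · rw [Pi.mulSingle_eq_same, hyl]
          · intro g' _ hne
            rw [Pi.mulSingle_eq_of_ne hne, map_one]
          · simp
    · rintro r ⟨hr, hrfix⟩
      rw [SetLike.mem_coe, mem_fixedField_range_iff] at hrfix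
      refine ⟨hFle hr, (mem_fixedField_range_iff _).2 fun w => ?_⟩
      have hw : w = baseHom H G w.left * inl w.right := by
        ext <;> simp [baseHom]
      rw [hw, map_mul, AlgEquiv.mul_apply]
      have := hrfix w.right
      rw [MonoidHom.comp_apply] at this
      rw [this, hFN _ _ hr]

end Wreath

/-! ### Rationality criteria and embeddings. -/

theorem isRationalOver_of_adjoin_eq_top {F E κ : Type*} [Field F] [Field E] [Algebra F E]
    [Finite κ] {s : κ → E} (hs : AlgebraicIndependent F s)
    (htop : adjoin F (Set.range s) = ⊤) : IsRationalOver F E := by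
  have e := (Finite.equivFin κ).symm
  have hs' := hs.comp e e.injective
  have htop' : adjoin F (Set.range (s ∘ e)) = ⊤ := by rw [e.surjective.range_comp, htop]
  exact ⟨Nat.card κ, ⟨(topEquiv.symm.trans (equivOfEq htop'.symm)).trans
    hs'.aevalEquivField.symm⟩⟩

theorem IsRationalOver.exists_family {F E : Type*} [Field F] [Field E] [Algebra F E]
    (h : IsRationalOver F E) : ∃ (n : ℕ) (s : Fin n → E), AlgebraicIndependent F s ∧
      adjoin F (Set.range s) = ⊤ := by
  obtain ⟨n, ⟨e⟩⟩ := h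
  have hs : AlgebraicIndependent F fun i : Fin n => e.symm (ratVar F i) :=
    (AlgHom.algebraicIndependent_iff e.symm.toAlgHom e.symm.injective).2
      (algebraicIndependent_ratVar (K := F) (X := Fin n))
  refine ⟨n, _, hs, ?_⟩
  have hlift : ratLift hs = e.symm.toAlgHom :=
    ratFunc_algHom_ext fun i => ratLift_ratVar hs i
  rw [← ratLift_fieldRange hs, hlift]
  exact AlgHom.fieldRange_eq_top.2 e.symm.surjective

/-- `E(X)` is rational over `F`, where `X` is a family of variables. -/
def IsRationalAfterAdjoining (F E X : Type*) [Field F] [Field E] [Algebra F E] : Prop :=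
  IsRationalOver F (RatFuncField X E)

/-- Rationality of `E / F` can be verified after embedding `E` in a larger field. -/
theorem isRationalOver_of_embedding {K F E R κ : Type*} [Field K] [Field F] [Field E] [Field R]
    [Algebra F E] [Algebra K R] [Finite κ] (Ψ : E →+* R) (A : IntermediateField K R)
    (hA : ∀ x, x ∈ A ↔ ∃ f : F, Ψ (algebraMap F E f) = x) {s : κ → R}
    (hs : AlgebraicIndependent A s) (hsΨ : ∀ k, ∃ e, Ψ e = s k)
    (hE : ∀ e, Ψ e ∈ A ⊔ adjoin K (Set.range s)) : IsRationalOver F E := by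
  choose s' hs' using hsΨ
  have hcomp : Ψ ∘ s' = s := funext hs'
  subst hcomp
  refine isRationalOver_of_adjoin_eq_top (s := s') ?_ ?_
  · exact hs.of_ringHom_of_comp_eq
      ((Ψ.comp (algebraMap F E)).codRestrict A fun f => (hA _).2 ⟨f, rfl⟩) Ψ
      (RingHom.injective _) rfl
  · let N : IntermediateField K R :=
      ((adjoin F (Set.range s')).toSubfield.map Ψ).toIntermediateField fun k => by
        obtain ⟨f, hf⟩ := (hA _).1 (A.algebraMap_mem k)
        exact ⟨algebraMap F E f, (adjoin F (Set.range s')).algebraMap_mem f, hf⟩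
    have hN : A ⊔ adjoin K (Set.range (Ψ ∘ s')) ≤ N := by
      refine sup_le (fun x hx => ?_) ?_
      · obtain ⟨f, hf⟩ := (hA _).1 hx
        exact ⟨algebraMap F E f, (adjoin F (Set.range s')).algebraMap_mem f, hf⟩
      · rw [adjoin_le_iff]
        rintro _ ⟨k, rfl⟩
        exact ⟨s' k, subset_adjoin _ _ ⟨k, rfl⟩, rfl⟩
    rw [eq_top_iff]
    intro e _
    obtain ⟨e', he', h⟩ := hN (hE e)
    exact Ψ.injective h ▸ he'

theorem isRationalAfterAdjoining_of_embedding {K F E R κ X : Type*} [Field K] [Field F] [Field E]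
    [Field R] [Algebra F E] [Algebra K R] [Finite κ] (Ψ : RatFuncField X E →+* R)
    (A : IntermediateField K R)
    (hA : ∀ x, x ∈ A ↔ ∃ f : F, Ψ (algebraMap E _ (algebraMap F E f)) = x) {s : κ → R}
    (hs : AlgebraicIndependent A s) (hsΨ : ∀ k, ∃ e, Ψ e = s k)
    (hE : ∀ e, Ψ e ∈ A ⊔ adjoin K (Set.range s)) : IsRationalAfterAdjoining F E X :=
  isRationalOver_of_embedding Ψ A (fun x => by
    simp_rw [IsScalarTower.algebraMap_apply F E (RatFuncField X E)]
    exact hA x) hs hsΨ hE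

/-- Extension of an embedding of `E` to a rational function field over `E`. -/
theorem exists_ratFunc_embedding {K E R X : Type*} [Field K] [Field E] [Field R]
    [Algebra K E] [Algebra K R] (j : E →ₐ[K] R) (C : IntermediateField K R)
    (hC : ∀ x, x ∈ C ↔ ∃ e, j e = x) {s : X → R} (hs : AlgebraicIndependent C s) :
    ∃ Ψ : RatFuncField X E →ₐ[K] R, (∀ e, Ψ (algebraMap E _ e) = j e) ∧
      ∀ r, r ∈ C ⊔ adjoin K (Set.range s) ↔ ∃ q, Ψ q = r := by
  let _ : Algebra E R := j.toRingHom.toAlgebra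
  have : IsScalarTower K E R := .of_algebraMap_eq fun k => (j.commutes k).symm
  have hs' : AlgebraicIndependent E s :=
    AlgebraicIndependent.of_ringHom_of_comp_eq
      (j.toRingHom.codRestrict C fun e => (hC _).2 ⟨e, rfl⟩) (RingHom.id R) hs
      (RingHom.injective _) rfl
  refine ⟨(ratLift hs').restrictScalars K, fun e => (ratLift hs').commutes e, fun r => ?_⟩
  have hr : (∃ q, (ratLift hs').restrictScalars K q = r) ↔
      r ∈ (adjoin E (Set.range s)).restrictScalars K := by
    rw [← ratLift_fieldRange hs']; rfl
  rw [hr]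
  refine ⟨fun h => ?_, fun h => ?_⟩
  · refine (sup_le (fun x hx => ?_) ?_ : C ⊔ adjoin K (Set.range s) ≤ _) h
    · obtain ⟨e, rfl⟩ := (hC _).1 hx
      exact (adjoin E (Set.range s)).algebraMap_mem e
    · rw [adjoin_le_iff]
      exact subset_adjoin E _
  · let N : IntermediateField E R :=
      (C ⊔ adjoin K (Set.range s)).toSubfield.toIntermediateField fun e =>
        (le_sup_left : C ≤ C ⊔ adjoin K (Set.range s)) ((hC _).2 ⟨e, rfl⟩)
    have : adjoin E (Set.range s) ≤ N := by
      rw [adjoin_le_iff]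
      exact fun x hx => (le_sup_right : adjoin K (Set.range s) ≤ C ⊔ _) (subset_adjoin K _ hx)
    exact this h

/-- Recognises a copy of `noetherField K Γ` wherever Γ permutes an independent family regularly:
`ratLift hy` is equivariant. -/
theorem mem_adjoin_inf_fixedField_iff {K R Γ : Type*} [Field K] [Field R] [Algebra K R] [Group Γ]
    (ρ : Γ →* (R ≃ₐ[K] R)) {y : Γ → R} (hy : AlgebraicIndependent K y)
    (hρ : ∀ a b, ρ a (y b) = y (a * b)) (x : R) :
    x ∈ adjoin K (Set.range y) ⊓ fixedField ρ.range ↔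
      ∃ e : noetherField K Γ, ((ratLift hy).comp (noetherField K Γ).val) e = x := by
  have hcomm : ∀ a q, ρ a (ratLift hy q) = ratLift hy (regularAction K Γ a q) := by
    intro a q
    have : (ρ a : R →ₐ[K] R).comp (ratLift hy) = (ratLift hy).comp
        (regularAction K Γ a : RatFuncField Γ K →ₐ[K] RatFuncField Γ K) := by
      refine ratFunc_algHom_ext fun b => ?_
      simp [hρ, regularAction_ratVar]
    exact DFunLike.congr_fun this q
  rw [← ratLift_fieldRange hy]
  constructor
  · rintro ⟨⟨q, rfl⟩, hfix⟩
    refine ⟨⟨q, (mem_noetherField_iff K Γ q).2 fun a => (ratLift hy).injective ?_⟩, rfl⟩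
    exact (hcomm a q).symm.trans ((mem_fixedField_range_iff ρ).1 hfix a)
  · rintro ⟨e, rfl⟩
    refine ⟨⟨e, rfl⟩, (mem_fixedField_range_iff ρ).2 fun a => ?_⟩
    have := (mem_noetherField_iff K Γ _).1 e.2 a
    exact (hcomm a _).trans (congrArg _ this)

theorem exists_algHom_comp_eq {K A B R : Type*} [Field K] [Field A] [Field B] [Field R]
    [Algebra K A] [Algebra K B] [Algebra K R] (f : A →ₐ[K] R) (g : B →ₐ[K] R)
    (h : ∀ a, ∃ b, g b = f a) : ∃ φ : A →ₐ[K] B, ∀ a, g (φ a) = f a := by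
  refine ⟨(AlgEquiv.ofInjectiveField g).symm.toAlgHom.comp (f.codRestrict g.range h), fun a => ?_⟩
  exact congrArg Subtype.val
    ((AlgEquiv.ofInjectiveField g).apply_symm_apply (f.codRestrict g.range h a))

theorem apply_mem_adjoin {K R Γ X : Type*} [Field K] [Field R] [Algebra K R] [Group Γ]
    (ρ : Γ →* (R ≃ₐ[K] R)) {y : X → R} (hρ : ∀ γ x, ρ γ (y x) ∈ adjoin K (Set.range y))
    (γ : Γ) (l : R) (hl : l ∈ adjoin K (Set.range y)) : ρ γ l ∈ adjoin K (Set.range y) := by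
  have : (adjoin K (Set.range y)).map (ρ γ : R →ₐ[K] R) ≤ adjoin K (Set.range y) := by
    rw [adjoin_map, adjoin_le_iff]
    rintro _ ⟨_, ⟨x, rfl⟩, rfl⟩
    exact hρ γ x
  exact this ⟨l, hl, rfl⟩

/-- In an algebraically independent family, the members of one part are algebraically independent
over the field generated by the other part. -/
theorem AlgebraicIndependent.over_adjoin {K R ι κ : Type*} [Field K] [Field R] [Algebra K R]
    {x : ι → R} {y : κ → R} (h : AlgebraicIndependent K (Sum.elim y x)) :
    AlgebraicIndependent (adjoin K (Set.range x)) y :=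
  algebraicIndependent_adjoin_iff.2 (AlgebraicIndependent.sumElim_iff.1 h).2

theorem AlgebraicIndependent.sumElim_of_le {K R ι κ : Type*} [Field K] [Field R] [Algebra K R]
    {A B : IntermediateField K R} (hAB : A ≤ B) {x : ι → R} {y : κ → R}
    (hx : AlgebraicIndependent A x) (hxB : ∀ i, x i ∈ B) (hy : AlgebraicIndependent B y) :
    AlgebraicIndependent A (Sum.elim y x) := by
  let _ : Algebra A B := (inclusion hAB).toRingHom.toAlgebra
  have : IsScalarTower A B R := .of_algebraMap_eq fun _ => rfl
  refine hx.sumElim_of_tower (S := B) ?_ hy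
  rintro _ ⟨i, rfl⟩
  exact ⟨⟨x i, hxB i⟩, rfl⟩

theorem exists_algEquiv_perm {F E ι : Type*} [Field F] [Field E] [Algebra F E] {v : ι → E}
    (hv : AlgebraicIndependent F v) (htop : adjoin F (Set.range v) = ⊤) (σ : Equiv.Perm ι) :
    ∃ τ : E ≃ₐ[F] E, ∀ i, τ (v i) = v (σ i) := by
  have hσ := hv.comp σ σ.injective
  have hσtop : adjoin F (Set.range (v ∘ σ)) = ⊤ := by rw [σ.surjective.range_comp, htop]
  have h1 : Function.Bijective (ratLift hv) :=
    ⟨(ratLift hv).injective, AlgHom.fieldRange_eq_top.1 (by rw [ratLift_fieldRange, htop])⟩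
  have h2 : Function.Bijective (ratLift hσ) :=
    ⟨(ratLift hσ).injective, AlgHom.fieldRange_eq_top.1 (by rw [ratLift_fieldRange, hσtop])⟩
  refine ⟨(AlgEquiv.ofBijective _ h1).symm.trans (AlgEquiv.ofBijective _ h2), fun i => ?_⟩
  have h3 : (AlgEquiv.ofBijective _ h1).symm (v i) = ratVar F i := by
    rw [AlgEquiv.symm_apply_eq]
    exact (ratLift_ratVar hv i).symm
  rw [AlgEquiv.trans_apply, h3]
  exact ratLift_ratVar hσ i

/-! ### Choosing generators that include an element of K(H). -/

/-- If `E = M(f)` with `f` transcendental over `M` and `E(J)` is rational over `K ⊆ M`, then, after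
adding one more variable, the generators over `K` can be chosen to contain `f`. -/
theorem exists_generators_containing {K E κ J : Type*} [Field K] [Field E] [Algebra K E]
    (M : IntermediateField K E) (f : E) (hf : AlgebraicIndependent M fun _ : Unit => f)
    (hM : M ⊔ adjoin K {f} = ⊤) {t : κ → RatFuncField J E} (ht : AlgebraicIndependent K t)
    (httop : adjoin K (Set.range t) = ⊤) :
    ∃ t' : Unit ⊕ κ → RatFuncField (J ⊕ Unit) E, AlgebraicIndependent K t' ∧
      adjoin K (Set.range t') = ⊤ ∧ t' (.inl ()) = algebraMap E _ f := by
  classical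
  have hvar : AlgebraicIndependent E (ratVar E : J ⊕ Unit → RatFuncField (J ⊕ Unit) E) :=
    algebraicIndependent_ratVar
  have hvl : AlgebraicIndependent E fun i : J => ratVar E (.inl i : J ⊕ Unit) :=
    hvar.comp _ Sum.inl_injective
  set L := adjoin E (Set.range fun i : J => ratVar E (.inl i : J ⊕ Unit)) with hL
  have hw : AlgebraicIndependent L fun i : Unit => ratVar E (.inr i : J ⊕ Unit) := by
    refine AlgebraicIndependent.over_adjoin ?_
    refine (algebraicIndependent_equiv' (Equiv.sumComm _ _) ?_).2 hvar
    ext (_ | _) <;> rfl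
  have : IsScalarTower K L (RatFuncField (J ⊕ Unit) E) := .of_algebraMap_eq fun _ => rfl
  let j : RatFuncField J E →ₐ[K] RatFuncField (J ⊕ Unit) E := (ratLift hvl).restrictScalars K
  have hjL : ∀ q, j q ∈ L := fun q => by
    rw [hL, ← ratLift_fieldRange hvl]; exact ⟨q, rfl⟩
  have htL : AlgebraicIndependent K
      (Sum.elim (fun i : Unit => ratVar E (.inr i : J ⊕ Unit)) (j ∘ t)) := by
    refine (ht.map' (f := j) j.injective).sumElim_of_tower (S := L) ?_ hw
    rintro _ ⟨i, rfl⟩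
    exact ⟨⟨j (t i), hjL _⟩, rfl⟩
  set t₁ := Sum.elim (fun i : Unit => ratVar E (.inr i : J ⊕ Unit)) (j ∘ t) with ht₁
  have htop_of : ∀ N : IntermediateField K (RatFuncField (J ⊕ Unit) E),
      (∀ e, algebraMap E _ e ∈ N) → (∀ i, ratVar E i ∈ N) → N = ⊤ := by
    intro N hE hN
    have : adjoin E (Set.range (ratVar E : J ⊕ Unit → _)) ≤
        N.toSubfield.toIntermediateField hE := by
      rw [adjoin_le_iff]
      rintro _ ⟨i, rfl⟩
      exact hN i
    rw [adjoin_ratVar] at this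
    exact eq_top_iff.2 fun x _ => this (mem_top (x := x))
  have ht₁top : adjoin K (Set.range t₁) = ⊤ := by
    have hj : ∀ q, j q ∈ adjoin K (Set.range t₁) := by
      intro q
      have : (adjoin K (Set.range t)).map j ≤ adjoin K (Set.range t₁) := by
        rw [adjoin_map]
        refine adjoin.mono K _ _ ?_
        rintro _ ⟨_, ⟨i, rfl⟩, rfl⟩
        exact ⟨.inr i, rfl⟩
      rw [httop] at this
      exact this ⟨q, mem_top, rfl⟩
    refine htop_of _ (fun e => ?_) ?_
    · have := hj (algebraMap E _ e)
      rwa [show j (algebraMap E _ e) = algebraMap E _ e from (ratLift hvl).commutes e] at this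
    · rintro (i | i)
      · have := hj (ratVar E i)
        rwa [show j (ratVar E i) = ratVar E (.inl i) from ratLift_ratVar hvl i] at this
      · exact subset_adjoin K _ ⟨.inl i, rfl⟩
  -- Over M, the element f is on the same footing as the variables, so an M-automorphism can swap it
  -- with the last variable, which is the first member of `t₁`.
  let v : (J ⊕ Unit) ⊕ Unit → RatFuncField (J ⊕ Unit) E :=
    Sum.elim (ratVar E) (algebraMap E _ ∘ fun _ : Unit => f)
  have hv : AlgebraicIndependent M v := AlgebraicIndependent.sumElim_comp hf hvar
  have hvtop : adjoin M (Set.range v) = ⊤ := by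
    have h1 : (adjoin M (Set.range v)).restrictScalars K = ⊤ := by
      refine htop_of _ (fun e => ?_) fun i => subset_adjoin M _ ⟨.inl i, rfl⟩
      have h2 : M ⊔ adjoin K {f} ≤ ((adjoin M (Set.range v)).restrictScalars K).comap
          (IsScalarTower.toAlgHom K E (RatFuncField (J ⊕ Unit) E)) := by
        refine sup_le (fun m hm => ?_) ?_
        · exact (adjoin M (Set.range v)).algebraMap_mem ⟨m, hm⟩
        · rw [adjoin_le_iff, Set.singleton_subset_iff]
          exact subset_adjoin M (Set.range v) ⟨.inr (), rfl⟩
      rw [hM] at h2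
      exact h2 (mem_top (x := e))
    exact eq_top_iff.2 fun x _ => (h1 ▸ mem_top : x ∈ (adjoin M (Set.range v)).restrictScalars K)
  obtain ⟨τ, hτ⟩ := exists_algEquiv_perm hv hvtop (Equiv.swap (.inl (.inr ())) (.inr ()))
  let τ' : RatFuncField (J ⊕ Unit) E →ₐ[K] RatFuncField (J ⊕ Unit) E :=
    (τ : _ →ₐ[M] _).restrictScalars K
  refine ⟨τ' ∘ t₁, htL.map' (f := τ') τ'.injective, ?_, ?_⟩
  · have := adjoin_map K (Set.range t₁) τ'
    rw [ht₁top, ← AlgHom.fieldRange_eq_map, ← Set.range_comp] at this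
    rw [← this]
    exact AlgHom.fieldRange_eq_top.2 τ.surjective
  · have := hτ (.inl (.inr ()))
    rw [Equiv.swap_apply_left] at this
    exact this

/-- `K(H)` is a rational function field in one variable over a field containing `K`, namely its
subfield of homogeneous elements of degree zero. -/
theorem exists_purely_transcendental_generator (K H : Type*) [Field K] [Group H] [Finite H] :
    ∃ (M : IntermediateField K (noetherField K H)) (f : noetherField K H),
      (AlgebraicIndependent M fun _ : Unit => f) ∧ M ⊔ adjoin K {f} = ⊤ := by
  classical
  let X : H → RatFuncField H K := ratVar K
  have hX : AlgebraicIndependent K X := algebraicIndependent_ratVar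
  have hX0 : ∀ h, X h ≠ 0 := hX.ne_zero
  let u : {h : H // h ≠ 1} → RatFuncField H K := fun h => X h * (X 1)⁻¹
  let y : Unit → RatFuncField H K := fun _ => X 1
  set L := adjoin K (Set.range u) with hL
  have hu : ∀ h, X h * (X 1)⁻¹ ∈ L := by
    intro h
    by_cases hh : h = 1
    · rw [hh, mul_inv_cancel₀ (hX0 1)]; exact one_mem _
    · exact subset_adjoin K _ ⟨⟨h, hh⟩, rfl⟩
  have hρ : ∀ a b, regularAction K H a (X b) = X (a * b) := regularAction_ratVar
  have hρu : ∀ a b, regularAction K H a (X b * (X 1)⁻¹) =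
      (X (a * b) * (X 1)⁻¹) * (X a * (X 1)⁻¹)⁻¹ := by
    intro a b
    rw [map_mul, map_inv₀, hρ, hρ, mul_one]
    field_simp [hX0]
  have hst := apply_mem_adjoin (regularAction K H) (y := u) fun a b => by
    rw [hρu]
    exact mul_mem (hu _) (inv_mem (hu _))
  have hfaith : ∀ a, (∀ l ∈ L, regularAction K H a l = l) → a = 1 := by
    intro a ha
    by_contra hne
    have h1 := ha _ (hu a)
    rw [hρu] at h1
    have h2 : X (a * a) * X 1 = X a * X a := by
      simp_rw [← div_eq_mul_inv] at h1
      rw [div_div_div_cancel_right₀ (hX0 1),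
        div_eq_div_iff (hX0 a) (hX0 1)] at h1
      exact h1
    have h3 : (MvPolynomial.X (a * a) * MvPolynomial.X 1 : MvPolynomial H K) =
        MvPolynomial.X a * MvPolynomial.X a := by
      apply algebraicIndependent_iff_injective_aeval.1 hX
      simpa using h2
    -- Setting the variable of a to 1 and all others to 0 gives 0 = 1, because a ≠ 1.
    have h4 := congrArg (MvPolynomial.eval fun h => if h = a then (1 : K) else 0) h3
    simp [Ne.symm hne] at h4
  have hXmem : ∀ N : IntermediateField K (RatFuncField H K), (∀ h, u h ∈ N) → X 1 ∈ N →
      ∀ h, X h ∈ N := by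
    intro N h1 h2 h
    by_cases hh : h = 1
    · rwa [hh]
    · have := mul_mem (h1 ⟨h, hh⟩) h2
      rwa [show u ⟨h, hh⟩ * X 1 = X h from inv_mul_cancel_right₀ (hX0 1) _] at this
  have hind : AlgebraicIndependent K (Sum.elim y u) := by
    refine (hX.exchange (s := Sum.elim y u) ?_ fun h => ?_).1
    · refine Nat.card_le_card_of_surjective
        (fun h : H => if hh : h = 1 then Sum.inl () else .inr ⟨h, hh⟩) ?_
      rintro (_ | ⟨h, hh⟩)
      · exact ⟨1, by simp⟩
      · exact ⟨h, by simp [hh]⟩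
    · refine isAlgebraic_algebraMap (⟨X h, ?_⟩ : adjoin K (Set.range (Sum.elim y u)))
      exact hXmem _ (fun h => subset_adjoin K (Set.range (Sum.elim y u)) ⟨.inr h, rfl⟩)
        (subset_adjoin K (Set.range (Sum.elim y u)) ⟨.inl (), rfl⟩) h
  -- The line spanned by X 1 over L is stable: a sends X 1 to X a, which is the ratio X a / X 1 in L
  -- times X 1.
  obtain ⟨s, hs, hfix⟩ := exists_fixed_generators (regularAction K H) L hst hfaith y
    hind.over_adjoin fun a _ => by
      have : regularAction K H a (X 1) = (⟨_, hu a⟩ : L) • X 1 := by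
        rw [hρ, mul_one]
        exact (inv_mul_cancel_right₀ (hX0 1) _).symm
      rw [this]
      exact Submodule.smul_mem _ _ (Submodule.subset_span (Set.mem_insert_of_mem _ ⟨(), rfl⟩))
  have htop : L ⊔ adjoin K (Set.range y) = ⊤ := by
    rw [eq_top_iff, ← adjoin_ratVar, adjoin_le_iff]
    rintro _ ⟨h, rfl⟩
    exact hXmem _ (fun h => (le_sup_left : L ≤ _) (subset_adjoin K _ ⟨h, rfl⟩))
      ((le_sup_right : adjoin K (Set.range y) ≤ _) (subset_adjoin K _ ⟨(), rfl⟩)) h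
  rw [htop, top_inf_eq] at hfix
  change noetherField K H = L ⊓ noetherField K H ⊔ _ at hfix
  have hsmem : s () ∈ noetherField K H := by
    rw [hfix]
    exact (le_sup_right : adjoin K (Set.range s) ≤ _) (subset_adjoin K _ ⟨(), rfl⟩)
  refine ⟨L.comap (noetherField K H).val, ⟨s (), hsmem⟩, ?_, ?_⟩
  · refine AlgebraicIndependent.of_ringHom_of_comp_eq (S := L)
      (((noetherField K H).val : _ →+* RatFuncField H K).restrict
        (L.comap (noetherField K H).val) L fun x hx => hx)
      (noetherField K H).val hs (RingHom.injective _) rfl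
  · set N := L.comap (noetherField K H).val ⊔ adjoin K {(⟨s (), hsmem⟩ : noetherField K H)}
    have hN : noetherField K H ≤ N.map (noetherField K H).val := by
      conv_lhs => rw [hfix]
      refine sup_le ?_ ?_
      · rintro x ⟨hx, hx'⟩
        exact ⟨⟨x, hx'⟩, (le_sup_left : L.comap (noetherField K H).val ≤ N) hx, rfl⟩
      · rw [adjoin_le_iff]
        rintro _ ⟨⟨⟩, rfl⟩
        exact ⟨⟨s (), hsmem⟩, (le_sup_right : _ ≤ N) (subset_adjoin K _ rfl), rfl⟩
    refine eq_top_iff.2 fun e _ => ?_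
    obtain ⟨e', he', h⟩ := hN e.2
    exact Subtype.ext h ▸ he'

/-! ### The common overfield and its block variables. -/

section Blocks

variable {K H G J : Type*} [Field K] [Group H] [Group G]

/-- The action of `H` on the disjoint union of `H` and a set of fixed points. -/
def sumFixedPerm (H J : Type*) [Group H] : H →* Equiv.Perm (H ⊕ J) where
  toFun h := Equiv.sumCongr (Equiv.mulLeft h) 1
  map_one' := by ext (_ | _) <;> simp
  map_mul' a b := by ext (_ | _) <;> simp [mul_assoc]

theorem sumFixedPerm_injective : Function.Injective (sumFixedPerm H J) := by
  intro a b hab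
  have := DFunLike.congr_fun hab (.inl 1)
  simpa [sumFixedPerm] using this

/-- The action of `H ≀ᵣ G` on the disjoint union of the regular `H ≀ᵣ G`-set and of copies of the
regular `G`-set. -/
def sumWreathPerm (H G J : Type*) [Group H] [Group G] :
    (H ≀ᵣ G) →* Equiv.Perm ((H ≀ᵣ G) ⊕ (J × G)) where
  toFun w := Equiv.sumCongr (Equiv.mulLeft w) (Equiv.prodCongr (.refl J) (Equiv.mulLeft w.right))
  map_one' := by ext (_ | _) <;> simp
  map_mul' a b := by ext (_ | ⟨_, _⟩) <;> simp [mul_assoc]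

/-- The generators of `K(H)(J)` over `K`, viewed as generators of the `H`-invariants of
`K(H ⊕ J)`. -/
theorem exists_generators_sumFixed [Finite H] [Finite J] {I : Type*}
    {t : I → RatFuncField J (noetherField K H)} (ht : AlgebraicIndependent K t)
    (httop : adjoin K (Set.range t) = ⊤) {i₀ : I} {e₀ : noetherField K H}
    (hi₀ : t i₀ = algebraMap _ _ e₀) :
    ∃ t' : I → RatFuncField (H ⊕ J) K, AlgebraicIndependent K t' ∧
      adjoin K (Set.range t') = fixedField (permAction K (sumFixedPerm H J)).range ∧
      t' i₀ ∈ adjoin K (Set.range fun h : H => ratVar K (.inl h : H ⊕ J)) := by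
  set ρ := permAction K (sumFixedPerm H J)
  let X : H → RatFuncField (H ⊕ J) K := fun h => ratVar K (.inl h)
  let y : J → RatFuncField (H ⊕ J) K := fun i => ratVar K (.inr i)
  have hvar : AlgebraicIndependent K (ratVar K : H ⊕ J → RatFuncField (H ⊕ J) K) :=
    algebraicIndependent_ratVar
  have hX : AlgebraicIndependent K X := hvar.comp _ Sum.inl_injective
  have hy : AlgebraicIndependent K (Sum.elim y X) := by
    refine (algebraicIndependent_equiv' (Equiv.sumComm _ _) ?_).2 hvar
    ext (_ | _) <;> rfl
  have hρX : ∀ a b, ρ a (X b) = X (a * b) := fun a b => permAction_ratVar _ _ _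
  have hρy : ∀ a i, ρ a (y i) = y i := fun a b => permAction_ratVar _ _ _
  set L := adjoin K (Set.range X)
  obtain ⟨s, hs, hfix⟩ := exists_fixed_generators ρ L
    (apply_mem_adjoin ρ fun a b => by rw [hρX]; exact subset_adjoin K _ ⟨_, rfl⟩)
    (fun a ha => by
      have := ha _ (subset_adjoin K _ ⟨1, rfl⟩)
      rw [hρX] at this
      simpa using hX.injective this)
    y hy.over_adjoin fun a i => by
      rw [hρy]
      exact Submodule.subset_span (Set.mem_insert_of_mem _ ⟨i, rfl⟩)
  have htop : L ⊔ adjoin K (Set.range y) = ⊤ := by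
    rw [eq_top_iff, ← adjoin_ratVar, adjoin_le_iff]
    rintro _ ⟨h | i, rfl⟩
    · exact (le_sup_left : L ≤ _) (subset_adjoin K _ ⟨h, rfl⟩)
    · exact (le_sup_right : adjoin K (Set.range y) ≤ _) (subset_adjoin K _ ⟨i, rfl⟩)
  rw [htop, top_inf_eq] at hfix
  have hC := mem_adjoin_inf_fixedField_iff ρ hX hρX
  -- Ψ maps K(H)(J) onto the H-invariants and extends the embedding of K(H), so it carries t to the
  -- required generators and t i₀ into L.
  obtain ⟨Ψ, hΨ, hΨr⟩ := exists_ratFunc_embedding _ _ hC (hs.of_le inf_le_left)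
  refine ⟨Ψ ∘ t, ht.map' (f := Ψ) Ψ.injective, ?_, ?_⟩
  · have h1 := adjoin_map K (Set.range t) Ψ
    rw [httop, ← AlgHom.fieldRange_eq_map, ← Set.range_comp] at h1
    rw [← h1, hfix]
    ext r
    exact (hΨr r).symm
  · rw [Function.comp_apply, hi₀, hΨ]
    exact ((hC _).2 ⟨e₀, rfl⟩).1

/-- The canonical element of `H ≀ᵣ G` lying over the point `(h, g)` of `H × G`. -/
def wreathRep (p : H × G) : H ≀ᵣ G := ⟨fun _ => p.1, p.2⟩

/-- The point of `H × G` to which an element of `H ≀ᵣ G` moves the base point. -/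
def wreathPoint (w : H ≀ᵣ G) : H × G := (w.left w.right, w.right)

omit [Group H] [Group G] in
theorem wreathPoint_wreathRep (p : H × G) : wreathPoint (wreathRep p) = p := rfl

/-- Equivariance of the orbit map of (1, 1) for the imprimitive action on H × G; hence left
multiplication permutes its fibres. -/
theorem wreathPoint_mul (w v : H ≀ᵣ G) : wreathPoint (w * v) =
    (w.left (w.right * (wreathPoint v).2) * (wreathPoint v).1, w.right * (wreathPoint v).2) := by
  simp [wreathPoint]

/-- The block variables in `K((H ≀ᵣ G) ⊕ (J × G))`: sums of the variables over the fibres of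
`wreathPoint`, and the additional variables. -/
noncomputable def blockVar (K H G J : Type*) [Field K] [Group H] [Group G] [Fintype (H ≀ᵣ G)]
    [DecidableEq (H × G)] : (H ⊕ J) × G → RatFuncField ((H ≀ᵣ G) ⊕ (J × G)) K
  | (.inl h, g) => ∑ w with wreathPoint w = (h, g), ratVar K (.inl w)
  | (.inr j, g) => ratVar K (.inr (j, g))

theorem permAction_blockVar [Fintype (H ≀ᵣ G)] [DecidableEq (H × G)]
    (w : H ≀ᵣ G) (l : H ⊕ J) (g : G) :
    permAction K (sumWreathPerm H G J) w (blockVar K H G J (l, g)) =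
      blockVar K H G J (sumFixedPerm H J (w.left (w.right * g)) l, w.right * g) := by
  rcases l with h | j
  · change permAction K (sumWreathPerm H G J) w (∑ v with wreathPoint v = (h, g),
      ratVar K (.inl v)) = ∑ v with wreathPoint v = (w.left (w.right * g) * h, w.right * g),
      ratVar K (.inl v)
    rw [map_sum]
    refine Finset.sum_equiv (Equiv.mulLeft w) (fun v => ?_) fun v _ => permAction_ratVar _ _ _
    simp only [Finset.mem_filter, Finset.mem_univ, true_and, Equiv.coe_mulLeft, wreathPoint_mul]
    constructor
    · intro hv; rw [hv]
    · intro hv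
      have h2 := congrArg Prod.snd hv
      have h1 := congrArg Prod.fst hv
      simp only [mul_right_inj] at h1 h2
      rw [h2, mul_right_inj] at h1
      exact Prod.ext h1 h2
  · exact permAction_ratVar _ _ _

/-- The variable at a representative is its fibre sum minus the other variables of the fibre. Only
subtraction is used, so N may be a subfield or merely an L-submodule. -/
theorem mem_of_blockVar_mem [Fintype (H ≀ᵣ G)] [DecidableEq (H × G)]
    {S : Type*} [SetLike S (RatFuncField ((H ≀ᵣ G) ⊕ (J × G)) K)]
    [AddSubgroupClass S (RatFuncField ((H ≀ᵣ G) ⊕ (J × G)) K)] (N : S)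
    (h1 : ∀ p, blockVar K H G J p ∈ N)
    (h2 : ∀ w ∉ Set.range (wreathRep : H × G → H ≀ᵣ G), ratVar K (.inl w) ∈ N)
    (w : H ≀ᵣ G) : ratVar K (.inl w : (H ≀ᵣ G) ⊕ (J × G)) ∈ N := by
  classical
  by_cases hw : w ∈ Set.range (wreathRep : H × G → H ≀ᵣ G)
  · obtain ⟨⟨h, g⟩, rfl⟩ := hw
    let f : (H ≀ᵣ G) → RatFuncField ((H ≀ᵣ G) ⊕ (J × G)) K := fun v => ratVar K (.inl v)
    have h3 : f (wreathRep (h, g)) +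
        ∑ v ∈ (Finset.univ.filter fun v => wreathPoint v = (h, g)).erase (wreathRep (h, g)),
          f v = blockVar K H G J (.inl h, g) := by
      refine Finset.add_sum_erase _ f ?_
      simp [wreathPoint_wreathRep]
    rw [← eq_sub_iff_add_eq] at h3
    change f (wreathRep (h, g)) ∈ N
    rw [h3]
    refine sub_mem (h1 _) (sum_mem fun v hv => h2 v ?_)
    rintro ⟨p, rfl⟩
    simp only [Finset.mem_erase, Finset.mem_filter, Finset.mem_univ, true_and,
      wreathPoint_wreathRep] at hv
    exact hv.1 (by rw [hv.2])
  · exact h2 w hw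

theorem algebraicIndependent_blockVar [Fintype (H ≀ᵣ G)] [DecidableEq (H × G)] [Finite H]
    [Finite G] [Finite J] :
    AlgebraicIndependent K (Sum.elim
      (fun w : {w : H ≀ᵣ G // w ∉ Set.range (wreathRep : H × G → H ≀ᵣ G)} =>
        ratVar K (.inl w.1 : (H ≀ᵣ G) ⊕ (J × G)))
      (blockVar K H G J)) := by
  classical
  refine ((algebraicIndependent_ratVar (K := K) (X := (H ≀ᵣ G) ⊕ (J × G))).exchange ?_ ?_).1
  · refine Nat.card_le_card_of_surjective (Sum.elim
      (fun w => if hw : w ∈ Set.range (wreathRep : H × G → H ≀ᵣ G) then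
        .inr (.inl (wreathPoint w).1, (wreathPoint w).2) else .inl ⟨w, hw⟩)
      fun p : J × G => .inr (.inr p.1, p.2)) ?_
    rintro (⟨w, hw⟩ | ⟨h | j, g⟩)
    · exact ⟨.inl w, by rw [Sum.elim_inl, dif_neg hw]⟩
    · exact ⟨.inl (wreathRep (h, g)), by
        rw [Sum.elim_inl, dif_pos ⟨_, rfl⟩, wreathPoint_wreathRep]⟩
    · exact ⟨.inr (j, g), rfl⟩
  · set v := Sum.elim
      (fun w : {w : H ≀ᵣ G // w ∉ Set.range (wreathRep : H × G → H ≀ᵣ G)} =>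
        ratVar K (.inl w.1 : (H ≀ᵣ G) ⊕ (J × G))) (blockVar K H G J)
    have hv : ∀ p, v p ∈ adjoin K (Set.range v) := fun p => subset_adjoin K _ ⟨p, rfl⟩
    rintro (w | ⟨j, g⟩)
    · exact isAlgebraic_algebraMap (⟨_, mem_of_blockVar_mem _ (fun p => hv (.inr p))
        (fun w hw => hv (.inl ⟨w, hw⟩)) w⟩ : adjoin K (Set.range v))
    · exact isAlgebraic_algebraMap (⟨_, hv (.inr (.inr j, g))⟩ : adjoin K (Set.range v))

theorem blockVar_inl_mem_adjoin [Fintype (H ≀ᵣ G)] [DecidableEq (H × G)] (h : H) (g : G) :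
    blockVar K H G J (.inl h, g) ∈ adjoin K (Set.range fun w : H ≀ᵣ G =>
      ratVar K (.inl w : (H ≀ᵣ G) ⊕ (J × G))) :=
  sum_mem fun w _ => subset_adjoin K _ ⟨w, rfl⟩

theorem blockVar_inr [Fintype (H ≀ᵣ G)] [DecidableEq (H × G)] (j : J) (g : G) :
    blockVar K H G J (.inr j, g) = ratVar K (.inr (j, g)) :=
  rfl

attribute [irreducible] blockVar

/-- The family `(t i, g)` split into the orbit of `t i₀` and the other members: the invariants of
`G` are purely transcendental over those in the field generated by the orbit of `t i₀`. -/
theorem exists_generators_over_orbit {R I : Type*} [Field R] [Algebra K R] [Finite G] [Finite I]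
    (ρ : G →* (R ≃ₐ[K] R)) {T : I × G → R} (hT : AlgebraicIndependent K T)
    (hρ : ∀ σ i g, ρ σ (T (i, g)) = T (i, σ * g)) (i₀ : I) :
    ∃ s : {i // i ≠ i₀} × G → R,
      AlgebraicIndependent (adjoin K (Set.range fun g => T (i₀, g))) s ∧
      adjoin K (Set.range T) ⊓ fixedField ρ.range =
        (adjoin K (Set.range fun g => T (i₀, g)) ⊓ fixedField ρ.range) ⊔
          adjoin K (Set.range s) := by
  let x : G → R := fun g => T (i₀, g)
  let y : {i // i ≠ i₀} × G → R := fun p => T (p.1, p.2)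
  have hxy : AlgebraicIndependent K (Sum.elim y x) := by
    have : Sum.elim y x = T ∘ Sum.elim (fun p => (p.1.1, p.2)) (fun g => (i₀, g)) := by
      ext (_ | _) <;> rfl
    rw [this]
    refine hT.comp _ ?_
    rintro (⟨⟨i, hi⟩, g⟩ | g) (⟨⟨i', hi'⟩, g'⟩ | g') h
    · simp_all
    · exact (hi (congrArg Prod.fst h)).elim
    · exact (hi' (congrArg Prod.fst h).symm).elim
    · simp_all
  set L := adjoin K (Set.range x)
  have hx : AlgebraicIndependent K x := hT.comp _ fun _ _ h => congrArg Prod.snd h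
  obtain ⟨s, hs, hfix⟩ := exists_fixed_generators ρ L
    (apply_mem_adjoin ρ fun a b => by rw [hρ]; exact subset_adjoin K _ ⟨_, rfl⟩)
    (fun a ha => by
      have := ha _ (subset_adjoin K _ ⟨1, rfl⟩)
      rw [hρ] at this
      simpa using hx.injective this)
    y hxy.over_adjoin fun a i => by
      rw [hρ]
      exact Submodule.subset_span (Set.mem_insert_of_mem _ ⟨(i.1, a * i.2), rfl⟩)
  refine ⟨s, hs, ?_⟩
  rw [← hfix]
  congr 1
  refine le_antisymm ?_ (sup_le ?_ ?_)
  · rw [adjoin_le_iff]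
    rintro _ ⟨⟨i, g⟩, rfl⟩
    by_cases hi : i = i₀
    · subst hi
      exact (le_sup_left : L ≤ _) (subset_adjoin K _ ⟨g, rfl⟩)
    · exact (le_sup_right : adjoin K (Set.range y) ≤ _)
        (subset_adjoin K _ ⟨(⟨i, hi⟩, g), rfl⟩)
  · refine adjoin.mono K _ _ ?_
    rintro _ ⟨g, rfl⟩
    exact ⟨(i₀, g), rfl⟩
  · refine adjoin.mono K _ _ ?_
    rintro _ ⟨p, rfl⟩
    exact ⟨(p.1, p.2), rfl⟩

/-- The invariants of `H ≀ᵣ G` are purely transcendental over those in the field generated by the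
block variables. -/
theorem exists_generators_over_blockVar [Finite H] [Finite G] [Finite J] [Fintype (H ≀ᵣ G)]
    [DecidableEq (H × G)] :
    ∃ s : {w : H ≀ᵣ G // w ∉ Set.range (wreathRep : H × G → H ≀ᵣ G)} →
        RatFuncField ((H ≀ᵣ G) ⊕ (J × G)) K,
      AlgebraicIndependent (adjoin K (Set.range (blockVar K H G J))) s ∧
      fixedField (permAction K (sumWreathPerm H G J)).range =
        (adjoin K (Set.range (blockVar K H G J)) ⊓
          fixedField (permAction K (sumWreathPerm H G J)).range) ⊔ adjoin K (Set.range s) := by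
  set ρ := permAction K (sumWreathPerm H G J)
  let z : {w : H ≀ᵣ G // w ∉ Set.range (wreathRep : H × G → H ≀ᵣ G)} →
      RatFuncField ((H ≀ᵣ G) ⊕ (J × G)) K := fun w => ratVar K (.inl w.1)
  set y := blockVar K H G J with hydef
  have hzy : AlgebraicIndependent K (Sum.elim z y) := algebraicIndependent_blockVar
  have hy : AlgebraicIndependent K y := (AlgebraicIndependent.sumElim_iff.1 hzy).1
  have hρy : ∀ w l g, ρ w (y (l, g)) = y (sumFixedPerm H J (w.left (w.right * g)) l,
    w.right * g) := permAction_blockVar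
  set L := adjoin K (Set.range y) with hL
  have hyL : ∀ p, y p ∈ L := fun p => subset_adjoin K _ ⟨p, rfl⟩
  have hfaith : ∀ w, (∀ l ∈ L, ρ w l = l) → w = 1 := by
    intro w hw
    have hfixpt : ∀ h g, (w.left (w.right * g) * h, w.right * g) = (h, g) := by
      intro h g
      have h1 := hw _ (hyL (.inl h, g))
      rw [hρy] at h1
      have h2 := hy.injective h1
      simpa [sumFixedPerm] using h2
    have hr : w.right = 1 := by simpa using congrArg Prod.snd (hfixpt 1 1)
    ext g
    · simpa [hr] using congrArg Prod.fst (hfixpt 1 g)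
    · exact hr
  have hspan : ∀ w v, ρ w (z v) ∈ Submodule.span L (insert 1 (Set.range z)) := by
    intro w v
    have h1 : ρ w (z v) = ratVar K (.inl (w * v.1)) := permAction_ratVar _ _ _
    rw [h1]
    refine mem_of_blockVar_mem _ (fun p => ?_) (fun u hu => ?_) _
    -- Block variables are scalars of L, that is, multiples of 1: the action on the remaining
    -- variables is affine, not linear.
    · have h2 := Submodule.smul_mem (Submodule.span L (insert 1 (Set.range z)))
        (⟨y p, hyL p⟩ : L) (Submodule.subset_span (Set.mem_insert _ _))
      rw [Algebra.smul_def, mul_one] at h2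
      exact h2
    · exact Submodule.subset_span (Set.mem_insert_of_mem _ ⟨⟨u, hu⟩, rfl⟩)
  obtain ⟨s, hs, hfix⟩ := exists_fixed_generators ρ L
    (apply_mem_adjoin ρ fun w p => by rw [hρy]; exact hyL _) hfaith z hzy.over_adjoin hspan
  have htop : L ⊔ adjoin K (Set.range z) = ⊤ := by
    have hyle : ∀ p, y p ∈ L ⊔ adjoin K (Set.range z) := fun p =>
      (le_sup_left : L ≤ _) (hyL p)
    rw [eq_top_iff, ← adjoin_ratVar, adjoin_le_iff]
    rintro _ ⟨w | ⟨j, g⟩, rfl⟩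
    · exact mem_of_blockVar_mem _ hyle (fun u hu =>
        (le_sup_right : adjoin K (Set.range z) ≤ _) (subset_adjoin K _ ⟨⟨u, hu⟩, rfl⟩)) w
    · rw [← blockVar_inr]
      exact hyle (.inr j, g)
  rw [htop, top_inf_eq] at hfix
  exact ⟨s, hs, hfix⟩

/-- The invariants of `H ≀ᵣ G` are purely transcendental over those in the field generated by the
regular variables. -/
theorem exists_generators_over_regular [Finite H] [Finite G] [Finite J] :
    ∃ s : J × G → RatFuncField ((H ≀ᵣ G) ⊕ (J × G)) K,
      AlgebraicIndependent (adjoin K (Set.range fun w : H ≀ᵣ G =>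
        ratVar K (.inl w : (H ≀ᵣ G) ⊕ (J × G)))) s ∧
      fixedField (permAction K (sumWreathPerm H G J)).range =
        (adjoin K (Set.range fun w : H ≀ᵣ G => ratVar K (.inl w : (H ≀ᵣ G) ⊕ (J × G))) ⊓
          fixedField (permAction K (sumWreathPerm H G J)).range) ⊔ adjoin K (Set.range s) := by
  set ρ := permAction K (sumWreathPerm H G J)
  let x : (H ≀ᵣ G) → RatFuncField ((H ≀ᵣ G) ⊕ (J × G)) K := fun w => ratVar K (.inl w)
  let u : J × G → RatFuncField ((H ≀ᵣ G) ⊕ (J × G)) K := fun p => ratVar K (.inr p)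
  have hvar : AlgebraicIndependent K
      (ratVar K : (H ≀ᵣ G) ⊕ (J × G) → RatFuncField ((H ≀ᵣ G) ⊕ (J × G)) K) :=
    algebraicIndependent_ratVar
  have hx : AlgebraicIndependent K x := hvar.comp _ Sum.inl_injective
  have hux : AlgebraicIndependent K (Sum.elim u x) := by
    refine (algebraicIndependent_equiv' (Equiv.sumComm _ _) ?_).2 hvar
    ext (_ | _) <;> rfl
  have hρx : ∀ a b, ρ a (x b) = x (a * b) := fun a b => permAction_ratVar _ _ _
  have hρu : ∀ (a : H ≀ᵣ G) j g, ρ a (u (j, g)) = u (j, a.right * g) :=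
    fun a b g => permAction_ratVar _ _ _
  obtain ⟨s, hs, hfix⟩ := exists_fixed_generators ρ (adjoin K (Set.range x))
    (apply_mem_adjoin ρ fun w p => by rw [hρx]; exact subset_adjoin K _ ⟨_, rfl⟩)
    (fun w hw => by
      have := hw _ (subset_adjoin K _ ⟨1, rfl⟩)
      rw [hρx] at this
      simpa using hx.injective this)
    u hux.over_adjoin fun w p => by
      rw [hρu]
      exact Submodule.subset_span (Set.mem_insert_of_mem _ ⟨_, rfl⟩)
  have htop : adjoin K (Set.range x) ⊔ adjoin K (Set.range u) = ⊤ := by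
    rw [eq_top_iff, ← adjoin_ratVar, adjoin_le_iff]
    rintro _ ⟨w | p, rfl⟩
    · exact (le_sup_left : adjoin K (Set.range x) ≤ _) (subset_adjoin K _ ⟨w, rfl⟩)
    · exact (le_sup_right : adjoin K (Set.range u) ≤ _) (subset_adjoin K _ ⟨p, rfl⟩)
  rw [htop, top_inf_eq] at hfix
  exact ⟨s, hs, hfix⟩

/-! ### Assembly. -/

/-- Comparison of two descriptions of the invariants of `H ≀ᵣ G` in a common overfield `R`. -/
theorem exists_rational_of_common_overfield {R κ X : Type*} [Field R] [Algebra K R] [Finite κ]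
    (ρ : (H ≀ᵣ G) →* (R ≃ₐ[K] R)) {x : (H ≀ᵣ G) → R} (hx : AlgebraicIndependent K x)
    (hρx : ∀ a b, ρ a (x b) = x (a * b)) {x₀ : G → R} (hx₀ : AlgebraicIndependent K x₀)
    (hρx₀ : ∀ σ g, ρ (inl σ) (x₀ g) = x₀ (σ * g))
    (hx₀x : ∀ g, x₀ g ∈ adjoin K (Set.range x))
    (hle : adjoin K (Set.range x₀) ⊓ fixedField (ρ.comp inl).range ≤ fixedField ρ.range)
    {s : κ → R}
    (hs : AlgebraicIndependent
      ↥(adjoin K (Set.range x₀) ⊓ fixedField (ρ.comp inl).range : IntermediateField K R) s)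
    (hsfix : fixedField ρ.range =
      (adjoin K (Set.range x₀) ⊓ fixedField (ρ.comp inl).range) ⊔ adjoin K (Set.range s))
    {s' : X → R} (hs' : AlgebraicIndependent (adjoin K (Set.range x)) s')
    (hs'fix : fixedField ρ.range =
      (adjoin K (Set.range x) ⊓ fixedField ρ.range) ⊔ adjoin K (Set.range s')) :
    ∃ φ : noetherField K G →ₐ[K] noetherField K (H ≀ᵣ G),
      IsRationalAfterAdjoining φ.fieldRange (noetherField K (H ≀ᵣ G)) X := by
  have hA := mem_adjoin_inf_fixedField_iff (ρ.comp inl) hx₀ hρx₀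
  have hC := mem_adjoin_inf_fixedField_iff ρ hx hρx
  set A := adjoin K (Set.range x₀) ⊓ fixedField (ρ.comp inl).range
  set C := adjoin K (Set.range x) ⊓ fixedField ρ.range
  have hAC : A ≤ C := by
    refine le_inf (inf_le_left.trans ?_) hle
    rw [adjoin_le_iff]
    rintro _ ⟨g, rfl⟩
    exact hx₀x g
  -- A is a copy of K(G) and C a copy of K(H ≀ G); φ is the inclusion A ≤ C.
  obtain ⟨φ, hφ⟩ := exists_algHom_comp_eq ((ratLift hx₀).comp (noetherField K G).val)
    ((ratLift hx).comp (noetherField K (H ≀ᵣ G)).val)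
    fun a => (hC _).1 (hAC ((hA _).2 ⟨a, rfl⟩))
  refine ⟨φ, ?_⟩
  obtain ⟨Ψ, hΨ, hΨr⟩ := exists_ratFunc_embedding _ C hC (hs'.of_le inf_le_left)
  rw [← hs'fix] at hΨr
  refine isRationalAfterAdjoining_of_embedding (Ψ : _ →+* R) A (fun r => ?_) hs (fun k => ?_)
    fun e => ?_
  · rw [hA]
    constructor
    · rintro ⟨e, rfl⟩
      refine ⟨⟨φ e, e, rfl⟩, ?_⟩
      exact (hΨ (φ e)).trans (hφ e)
    · rintro ⟨⟨_, e, rfl⟩, rfl⟩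
      exact ⟨e, ((hΨ (φ e)).trans (hφ e)).symm⟩
  · refine (hΨr _).1 ?_
    rw [hsfix]
    exact (le_sup_right : adjoin K (Set.range s) ≤ _) (subset_adjoin K _ ⟨k, rfl⟩)
  · rw [← hsfix]
    exact (hΨr _).2 ⟨e, rfl⟩

/-- The hypothesis on t i₀ is what places the copy of K(G) inside K(H ≀ G) itself, before the
variables X are adjoined. -/
theorem exists_rational_over_noetherField [Finite H] [Finite G] [Finite J] {I : Type*} [Finite I]
    {t : I → RatFuncField J (noetherField K H)} (ht : AlgebraicIndependent K t)
    (httop : adjoin K (Set.range t) = ⊤) {i₀ : I} {e₀ : noetherField K H}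
    (hi₀ : t i₀ = algebraMap _ _ e₀) {X : Type*} (eX : X ≃ J × G) :
    ∃ φ : noetherField K G →ₐ[K] noetherField K (H ≀ᵣ G),
      IsRationalAfterAdjoining φ.fieldRange (noetherField K (H ≀ᵣ G)) X := by
  classical
  have := Fintype.ofFinite (H ≀ᵣ G)
  obtain ⟨t', ht', ht'fix, hi₀'⟩ := exists_generators_sumFixed ht httop hi₀
  have hy : AlgebraicIndependent K (blockVar K H G J) :=
    (AlgebraicIndependent.sumElim_iff.1 algebraicIndependent_blockVar).1
  obtain ⟨hT, hTinl, hTfix⟩ :=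
    wreath_invariants hy sumFixedPerm_injective permAction_blockVar ht' ht'fix
  obtain ⟨s₁, hs₁, hs₁fix⟩ := exists_generators_over_blockVar (K := K) (H := H) (G := G) (J := J)
  obtain ⟨s₂, hs₂, hs₂fix⟩ := exists_generators_over_regular (K := K) (H := H) (G := G) (J := J)
  set y := blockVar K H G J with hydef
  set ρ := permAction K (sumWreathPerm H G J) with hρdef
  set T : I × G → RatFuncField ((H ≀ᵣ G) ⊕ (J × G)) K :=
    fun p => ratLift (hy.fiber p.2) (t' p.1) with hTdef
  obtain ⟨s₃, hs₃, hs₃fix⟩ := exists_generators_over_orbit (ρ.comp inl) hT hTinl i₀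
  have hx : AlgebraicIndependent K
      fun w : H ≀ᵣ G => ratVar K (.inl w : (H ≀ᵣ G) ⊕ (J × G)) :=
    algebraicIndependent_ratVar.comp _ Sum.inl_injective
  have hx₀ : AlgebraicIndependent K fun g => T (i₀, g) :=
    hT.comp _ fun _ _ h => congrArg Prod.snd h
  have hAy : adjoin K (Set.range fun g => T (i₀, g)) ⊓ fixedField (ρ.comp inl).range ≤
      adjoin K (Set.range y) ⊓ fixedField ρ.range := by
    rw [hTfix, hs₃fix]
    exact le_sup_left
  have hs₃y : ∀ k, s₃ k ∈ adjoin K (Set.range y) := by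
    have h1 : adjoin K (Set.range s₃) ≤ adjoin K (Set.range y) ⊓ fixedField ρ.range := by
      rw [hTfix, hs₃fix]
      exact le_sup_right
    exact fun k => (h1 (subset_adjoin K _ ⟨k, rfl⟩)).1
  -- Tower: s₃ lies in K(y) and is independent over the copy of K(G), while s₁ is independent over
  -- K(y).
  have hs := (hs₃.of_le inf_le_left).sumElim_of_le (hAy.trans inf_le_left) hs₃y hs₁
  rw [hTfix, hs₃fix, sup_assoc, ← adjoin_union, Set.union_comm, ← Set.Sum.elim_range] at hs₁fix
  refine exists_rational_of_common_overfield ρ hx (fun a b => permAction_ratVar _ _ _) hx₀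
    (fun σ g => hTinl σ i₀ g) (fun g => ?_) (hAy.trans inf_le_right) hs hs₁fix
    (s' := s₂ ∘ eX) (hs₂.comp eX eX.injective) ?_
  · have h1 : (adjoin K (Set.range fun h : H => ratVar K (.inl h : H ⊕ J))).map
        (ratLift (hy.fiber g)) ≤
          adjoin K (Set.range fun w : H ≀ᵣ G => ratVar K (.inl w : (H ≀ᵣ G) ⊕ (J × G))) := by
      rw [adjoin_map, adjoin_le_iff]
      rintro _ ⟨_, ⟨h, rfl⟩, rfl⟩
      exact (ratLift_ratVar (hy.fiber g) (.inl h)).symm ▸ blockVar_inl_mem_adjoin h g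
    exact h1 ⟨_, hi₀', rfl⟩
  · rw [eX.surjective.range_comp]
    exact hs₂fix

end Blocks

theorem bijective_algebraMap_ratFunc {E X : Type*} [Field E] [IsEmpty X] :
    Function.Bijective (algebraMap E (RatFuncField X E)) := by
  refine ⟨(algebraMap E (RatFuncField X E)).injective, fun q => ?_⟩
  have h : q ∈ adjoin E (Set.range (ratVar E : X → RatFuncField X E)) :=
    adjoin_ratVar (K := E) (X := X) ▸ mem_top
  rw [Set.range_eq_empty, adjoin_empty] at h
  exact mem_bot.1 h

theorem IsRationalAfterAdjoining.of_isEmpty {F E X : Type*} [Field F] [Field E] [Algebra F E]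
    [IsEmpty X] (h : IsRationalAfterAdjoining F E X) : IsRationalOver F E := by
  obtain ⟨n, ⟨e⟩⟩ := h
  exact ⟨n, ⟨(AlgEquiv.ofBijective (IsScalarTower.toAlgHom F E (RatFuncField X E))
    bijective_algebraMap_ratFunc).trans e⟩⟩

/-- K(x(h)) is algebraic over K(H), so K(H) has transcendence degree |H| > 0; this provides a
generator to serve as i₀. -/
theorem ne_zero_of_adjoin_noetherField_eq_top {K H : Type*} [Field K] [Group H] [Finite H] {n : ℕ}
    {s : Fin n → noetherField K H} (hs : adjoin K (Set.range s) = ⊤) : n ≠ 0 := by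
  rintro rfl
  have hle : noetherField K H ≤ adjoin K (Set.range (Subtype.val ∘ s)) := by
    intro q hq
    have h1 := adjoin_map K (Set.range s) (noetherField K H).val
    rw [hs, ← Set.range_comp] at h1
    exact h1.le ⟨⟨q, hq⟩, mem_top, rfl⟩
  have h := ((algebraicIndependent_ratVar (K := K) (X := H)).exchange (s := Subtype.val ∘ s)
    (by simp) fun h => ?_).2
  · simp only [Nat.card_eq_fintype_card, Fintype.card_fin] at h
    exact Nat.card_pos.ne h
  · exact (isAlgebraic_inf_fixedField (regularAction K H) ⊤ (fun _ _ _ => mem_top)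
      mem_top).map_of_le (AlgHom.id K _) fun a ha => hle ha.2

theorem theorem1p10 (K : Type*) [Field K] (H G : Type*) [Group H] [Finite H]
    [Group G] [Finite G] :
    (IsRationalOver K (noetherField K H) →
      ∃ φ : noetherField K G →ₐ[K] noetherField K (H ≀ᵣ G),
        IsRationalOver φ.fieldRange (noetherField K (H ≀ᵣ G))) ∧
    (IsStablyRationalOver K (noetherField K H) →
      ∃ φ : noetherField K G →ₐ[K] noetherField K (H ≀ᵣ G),
        IsStablyRationalOver φ.fieldRange (noetherField K (H ≀ᵣ G))) := by
  constructor
  · intro h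
    obtain ⟨n, s, hs, hsgen⟩ := h.exists_family
    have hn := ne_zero_of_adjoin_noetherField_eq_top hsgen
    -- With no extra variables every generator already comes from K(H), so index 0 will do.
    let j := IsScalarTower.toAlgHom K (noetherField K H) (RatFuncField (Fin 0) (noetherField K H))
    have htop : adjoin K (Set.range (j ∘ s)) = ⊤ := by
      have h1 := adjoin_map K (Set.range s) j
      rw [hsgen, ← AlgHom.fieldRange_eq_map, ← Set.range_comp] at h1
      rw [← h1]
      exact AlgHom.fieldRange_eq_top.2 bijective_algebraMap_ratFunc.2
    obtain ⟨φ, hφ⟩ := exists_rational_over_noetherField (G := G) (hs.map' (f := j) j.injective)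
      htop (i₀ := ⟨0, Nat.pos_of_ne_zero hn⟩) rfl (Equiv.equivOfIsEmpty (Fin 0) (Fin 0 × G))
    exact ⟨φ, hφ.of_isEmpty⟩
  · rintro ⟨m, h⟩
    obtain ⟨n, s, hs, hsgen⟩ := h.exists_family
    obtain ⟨M, f, hf, hM⟩ := exists_purely_transcendental_generator K H
    obtain ⟨t, ht, httop, htf⟩ := exists_generators_containing M f hf hM hs hsgen
    obtain ⟨φ, hφ⟩ := exists_rational_over_noetherField (G := G) ht httop htf
      -- The m given variables and the one used for the swap, repeated for each element of G.
      (Finite.equivFin ((Fin m ⊕ Unit) × G)).symm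
    exact ⟨φ, _, hφ⟩
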